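/- For $a\in\mathbb R$, $k\in\mathbb N_0$ let $(a)_k=a(a+1)\cdots(a+k-1)$. For a vector $y=(y_1,\dots,y_n)$ put $|y|=y_1+\cdots+y_n$, $|\mathbf y_j|=y_1+\cdots+y_j$, $|\mathbf y^j|=y_j+\cdots+y_n$ (empty sums are $0$). Let $d\ge 1$, $\nu\in\mathbb N_0^d$, $x\in\mathbb R^d$, $\ell=(\ell_1,\dots,\ell_{d+1})$, and let $$\widehat{\mathsf Q}_\nu(x;\ell,N)=\frac1{(-N)_{|\nu|}}\prod_{j=1}^d(-N_j)_{\nu_j}\,{}_3F_2\!\left(\begin{matrix}-\nu_j,\ \nu_j-\ell_j-\mathsf a_j-1,\ -x_j\\ -\ell_j,\ -N_j\end{matrix};1\right),$$ where $\mathsf a_j=|\boldsymbol\ell^{j+1}|-2|\boldsymbol\nu^{j+1}|$ and $N_j=N-|\mathbf x_{j-1}|-|\boldsymbol\nu^{j+1}|$; here $(-N_j)_{\nu_j}/(-N_j)_m$ is read as $(-N_j+m)_{\nu_j-m}$ in the terms of the hypergeometric sum, so that $\widehat{\mathsf Q}_\nu$ is a polynomial in $x$. For $1\le i\le d$ define $$\begin{aligned}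 B_i^{0,0}&=|\boldsymbol\nu^{i}|(|\boldsymbol\nu^{i}|-|\boldsymbol\ell^{i}|-1)+|\boldsymbol\nu^{i+1}|(|\boldsymbol\nu^{i+1}|-|\boldsymbol\ell^{i+1}|-1)+\tfrac12|\boldsymbol\ell^{i+1}|(|\boldsymbol\ell^{i}|+2),\\ B_i^{0,1}&=-\nu_i(\nu_i+2|\boldsymbol\nu^{i+1}|-|\boldsymbol\ell^{i}|-1),\qquad B_i^{0,-1}=(\ell_i-\nu_i)(\nu_i+2|\boldsymbol\nu^{i+1}|-|\boldsymbol\ell^{i+1}|-1),\\ B_i^{1,0}&=(\ell_i-\nu_i)(\nu_i+2|\boldsymbol\nu^{i+1}|-|\boldsymbol\ell^{i}|-1),\qquad B_i^{-1,0}=-\nu_i(\nu_i+2|\boldsymbol\nu^{i+1}|-|\boldsymbol\ell^{i+1}|-1),\\ B_i^{1,1}&=(\nu_i+2|\boldsymbol\nu^{i+1}|-|\boldsymbol\ell^{i}|-1)(\nu_i+2|\boldsymbol\nu^{i+1}|-|\boldsymbol\ell^{i}|),\qquad B_i^{-1,1}=\nu_i(\nu_i-1),\\ B_i^{1,-1}&=(\ell_i-\nu_i)(\ell_i-\nu_i-1),\qquad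 B_i^{-1,-1}=(\nu_i+2|\boldsymbol\nu^{i+1}|-|\boldsymbol\ell^{i+1}|-1)(\nu_i+2|\boldsymbol\nu^{i+1}|-|\boldsymbol\ell^{i+1}|-2), \end{aligned}$$ $B_0^{0,0}=-N+|\ell|/2$, $B_0^{0,1}=N-|\nu|$, $B_0^{0,-1}=|\nu|-|\ell|+N-1$, and, with $s_i=2|\boldsymbol\nu^i|-|\boldsymbol\ell^i|$, $b_i^0=s_i(s_i-2)/2$, $b_i^1=s_i(s_i-1)$, $b_i^{-1}=(s_i-2)(s_i-1)$. For $\mu\in\{-1,0,1\}^d$ and $\mu_0=\mu_{d+1}=0$ let $C_\mu=\prod_{i=0}^dB_i^{\mu_i,\mu_{i+1}}\big/\prod_{i=1}^db_i^{\mu_i}$, and let $$\mathcal L_d^\nu(\nu;\ell;N)=\sum_{0\ne\mu\in\{-1,0,1\}^d}C_\mu\Big(\prod_{i=1}^dE_{\nu_i}^{\mu_i-\mu_{i+1}}-1\Big),$$ where $E_{\nu_i}f_\nu=f_{\nu+e_i}$ and values $f_{\nu'}$ at indices with a negative component (whose coefficients vanish) are ignored. For $1\le k\le d$ put $$\mathcal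 L_k^\nu=\mathcal L_k^\nu\big(\nu_1,\dots,\nu_k;\ \ell_1,\dots,\ell_k,|\boldsymbol\ell^{k+1}|-2|\boldsymbol\nu^{k+1}|;\ N-|\boldsymbol\nu^{k+1}|\big)$$ (for $k=d$ this is $\mathcal L_d^\nu(\nu;\ell;N)$), and consider the equations $$\mathcal L_k^\nu\,\widehat{\mathsf Q}_\nu(x;\ell,N)=|\mathbf x_k|\,\widehat{\mathsf Q}_\nu(x;\ell,N),\qquad k=1,\dots,d.\tag{$*$}$$ (1) Generic parameters. Let $\ell\in\mathbb R^{d+1}$, $N\in\mathbb R$ with $N\notin\mathbb N_0$, and $\ell_i\notin\mathbb N_0$, $|\boldsymbol\ell^i|\notin\mathbb Z$ for $1\le i\le d$. Then $(*)$ holds for all $\nu\in\mathbb N_0^d$ and all $x\in\mathbb R^d$, and $\mathcal L_1^\nu,\dots,\mathcal L_d^\nu$ commute as operators on functions on $\mathbb N_0^d$. (2) Integer parameters. Let $\ell_i,N\in\mathbb N_0$ with $\ell_i\le N$ and $\ell_i+\ell_j\ge N$ for $i\ne j$, and put $H=\{\nu\in\mathbb N_0^d:|\nu|\le N,\ |\nu|\le|\ell|-N,\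 \nu_j\le\ell_j,\ \nu_j\le\mathsf a_j,\ 1\le j\le d\}$ and $V=\{x\in\mathbb N_0^d:x_i\le\ell_i\ (1\le i\le d),\ N-\ell_{d+1}\le|x|\le N\}$. Let $1\le k\le d$. (a) If $\nu$ and all indices with nonnegative components that occur on the left-hand side of $(*)$ belong to $H$, then the $k$-th equation $(*)$ holds for all $x\in\mathbb R^d$. (b) If $\nu\in H$ and the denominators $b_i^{0},b_i^{\pm1}$, $1\le i\le k$, do not vanish at $\nu$, then the $k$-th equation $(*)$ holds for all $x\in V$, where terms with coefficient $0$ are omitted. (c) For all $1\le j,k\le d$ one has $(\mathcal L_j^\nu\mathcal L_k^\nu f)_\nu=(\mathcal L_k^\nu\mathcal L_j^\nu f)_\nu$ for every function $f$ on $\mathbb N_0^d$ and every $\nu\in\mathbb N_0^d$ such that the denominators of all coefficients involved do not vanish (those of $\mathcal L_j^\nu$ and $\mathcal L_k^\nu$ at $\nu$, those of $\mathcal L_k^\nu$ at the nonnegative indices occurring in $\mathcal L_j^\nu$, and those of $\mathcal L_j^\nu$ at the nonnegative indices occurring in $\mathcal L_k^\nu$). -/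

import Mathlib

namespace HahnRec

noncomputable section

/-- The Pochhammer symbol `(a)_k = a (a+1) ⋯ (a+k-1)`. -/
def poch (a : ℝ) (k : ℕ) : ℝ := (ascPochhammer ℝ k).eval a

/-- `|y_j| = y_1 + ⋯ + y_j`, where `y_i` (counted from `1`) is `y ⟨i - 1, _⟩`. -/
def headSum {M : Type} [AddCommMonoid M] {n : ℕ} (y : Fin n → M) (j : ℕ) : M :=
  ∑ i : Fin n with i.val + 1 ≤ j, y i

/-- `|y^j| = y_j + ⋯ + y_n`, where `y_i` (counted from `1`) is `y ⟨i - 1, _⟩`;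
it is `0` for `j > n`. -/
def tailSum {M : Type} [AddCommMonoid M] {n : ℕ} (y : Fin n → M) (j : ℕ) : M :=
  ∑ i : Fin n with j ≤ i.val + 1, y i

/-! ### Hahn polynomials -/

/-- The Hahn polynomial with parameters `-l₁ - 1`, `-l₂ - 1`, as a terminating
hypergeometric sum `₃F₂(-n, n - l₁ - l₂ - 1, -x; -l₁, -M; 1)`. -/
def hahn (n : ℕ) (x l₁ l₂ M : ℝ) : ℝ :=
  ∑ k ∈ Finset.range (n + 1),
    poch (-(n : ℝ)) k * poch (n - l₁ - l₂ - 1) k * poch (-x) k /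
      (poch (-l₁) k * poch (-M) k * (k.factorial : ℝ))

/-- The product `(-M)_n · hahn n x l₁ l₂ M`, with `(-M)_n / (-M)_k` written as
`(-M + k)_{n-k}`, so that it is a polynomial in `x` and `M`
(see `hahnReg_eq`). -/
def hahnReg (n : ℕ) (x l₁ l₂ M : ℝ) : ℝ :=
  ∑ k ∈ Finset.range (n + 1),
    poch (-(n : ℝ)) k * poch (n - l₁ - l₂ - 1) k * poch (-x) k /
      (poch (-l₁) k * (k.factorial : ℝ)) * poch (-M + k) (n - k)

theorem poch_add (a : ℝ) (k m : ℕ) : poch a (k + m) = poch a k * poch (a + k) m := by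
  unfold poch
  rw [← ascPochhammer_mul]
  simp [Polynomial.eval_comp]

theorem hahnReg_eq (n : ℕ) (x l₁ l₂ M : ℝ) (h : poch (-M) n ≠ 0) :
    hahnReg n x l₁ l₂ M = poch (-M) n * hahn n x l₁ l₂ M := by
  unfold hahnReg hahn
  rw [Finset.mul_sum]
  refine Finset.sum_congr rfl fun k hk => ?_
  have hkn : k + (n - k) = n := by
    have := Finset.mem_range.mp hk
    omega
  have h1 : poch (-M) n = poch (-M) k * poch (-M + k) (n - k) := by
    rw [← poch_add, hkn]
  have h2 : poch (-M) k ≠ 0 := fun h0 => h (by rw [h1, h0, zero_mul])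
  rw [h1, mul_assoc (poch (-l₁) k), mul_comm (poch (-M) k) (k.factorial : ℝ), ← mul_assoc,
    ← div_div]
  field_simp

/-- The normalized Hahn polynomial `Q̂_ν(x; ℓ, N)` in `d` variables. -/
def hahnQ {d : ℕ} (ν : Fin d → ℕ) (x : Fin d → ℝ) (ℓ : Fin (d + 1) → ℝ) (N : ℝ) : ℝ :=
  1 / poch (-N) (∑ i, ν i) *
    ∏ i : Fin d,
      hahnReg (ν i) (x i) (ℓ i.castSucc)
        (tailSum ℓ (i.val + 2) - 2 * (tailSum ν (i.val + 2) : ℕ))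
        (N - headSum x i.val - (tailSum ν (i.val + 2) : ℕ))

/-! ### The operators acting on the indices -/

/-- The coefficients `B_i^{p,q}`, `1 ≤ i ≤ d`. The first argument of type `Fin d` is `i - 1`. -/
def B {d : ℕ} (ν : Fin d → ℕ) (ℓ : Fin (d + 1) → ℝ) (i : Fin d) (p q : SignType) : ℝ :=
  let n : ℝ := (ν i : ℝ)
  let l : ℝ := ℓ i.castSucc
  let n₀ : ℝ := ((tailSum ν (i.val + 1) : ℕ) : ℝ)
  let n₁ : ℝ := ((tailSum ν (i.val + 2) : ℕ) : ℝ)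
  let l₀ : ℝ := tailSum ℓ (i.val + 1)
  let l₁ : ℝ := tailSum ℓ (i.val + 2)
  match p, q with
  | .zero, .zero => n₀ * (n₀ - l₀ - 1) + n₁ * (n₁ - l₁ - 1) + l₁ * (l₀ + 2) / 2
  | .zero, .pos => -n * (n + 2 * n₁ - l₀ - 1)
  | .zero, .neg => (l - n) * (n + 2 * n₁ - l₁ - 1)
  | .pos, .zero => (l - n) * (n + 2 * n₁ - l₀ - 1)
  | .neg, .zero => -n * (n + 2 * n₁ - l₁ - 1)
  | .pos, .pos => (n + 2 * n₁ - l₀ - 1) * (n + 2 * n₁ - l₀)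
  | .neg, .pos => n * (n - 1)
  | .pos, .neg => (l - n) * (l - n - 1)
  | .neg, .neg => (n + 2 * n₁ - l₁ - 1) * (n + 2 * n₁ - l₁ - 2)

/-- The coefficients `B_0^{0,q}`. -/
def B₀ {d : ℕ} (ν : Fin d → ℕ) (ℓ : Fin (d + 1) → ℝ) (N : ℝ) (q : SignType) : ℝ :=
  let n : ℝ := ((∑ i, ν i : ℕ) : ℝ)
  match q with
  | .zero => -N + (∑ i, ℓ i) / 2
  | .pos => N - n
  | .neg => n - (∑ i, ℓ i) + N - 1

/-- The denominators `b_i^p`, `1 ≤ i ≤ d`. The argument of type `Fin d` is `i - 1`. -/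
def b {d : ℕ} (ν : Fin d → ℕ) (ℓ : Fin (d + 1) → ℝ) (i : Fin d) (p : SignType) : ℝ :=
  let s : ℝ := 2 * ((tailSum ν (i.val + 1) : ℕ) : ℝ) - tailSum ℓ (i.val + 1)
  match p with
  | .zero => s * (s - 2) / 2
  | .pos => s * (s - 1)
  | .neg => (s - 2) * (s - 1)

/-- `μ_j` for every `j`, counted from `1`, with `μ_j = 0` for `j = 0` and for `j > k`. -/
def ext {k : ℕ} (μ : Fin k → SignType) (j : ℕ) : SignType :=
  if h : 1 ≤ j ∧ j ≤ k then μ ⟨j - 1, by omega⟩ else 0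

/-- The coefficient `C_μ = ∏_{k=0}^d B_k^{μ_k, μ_{k+1}} / ∏_{k=1}^d b_k^{μ_k}`. -/
def C {d : ℕ} (ν : Fin d → ℕ) (ℓ : Fin (d + 1) → ℝ) (N : ℝ) (μ : Fin d → SignType) : ℝ :=
  B₀ ν ℓ N (ext μ 1) * (∏ i : Fin d, B ν ℓ i (ext μ (i.val + 1)) (ext μ (i.val + 2))) /
    ∏ i : Fin d, b ν ℓ i (ext μ (i.val + 1))

/-- The index `ν` shifted by `∏_{i=1}^k E_{ν_i}^{μ_i - μ_{i+1}}`; its components may be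
negative. -/
def shift {d k : ℕ} (ν : Fin d → ℕ) (μ : Fin k → SignType) : Fin d → ℤ :=
  fun i => (ν i : ℤ) + ((ext μ (i.val + 1) : ℤ) - (ext μ (i.val + 2) : ℤ))

/-- The value of `f` at an integer index; the value at an index with a negative component is
ignored, that is, `0`. -/
def atIndex {d : ℕ} (f : (Fin d → ℕ) → ℝ) (n : Fin d → ℤ) : ℝ :=
  if ∀ i, 0 ≤ n i then f (fun i => (n i).toNat) else 0

/-- The operator `L^ν_d(ν; ℓ; N)`. -/
def recOpFull {d : ℕ} (ℓ : Fin (d + 1) → ℝ) (N : ℝ) (f : (Fin d → ℕ) → ℝ) (ν : Fin d → ℕ) : ℝ :=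
  ∑ μ : Fin d → SignType with μ ≠ 0, C ν ℓ N μ * (atIndex f (shift ν μ) - f ν)

/-- The first `k` indices `(ν_1, …, ν_k)`. -/
def headIdx {d k : ℕ} (hk : k ≤ d) (ν : Fin d → ℕ) : Fin k → ℕ := fun i => ν (Fin.castLE hk i)

/-- The parameters `(ℓ_1, …, ℓ_k, |ℓ^{k+1}| - 2 |ν^{k+1}|)`. -/
def headPar {d k : ℕ} (hk : k ≤ d) (ν : Fin d → ℕ) (ℓ : Fin (d + 1) → ℝ) : Fin (k + 1) → ℝ :=
  Fin.snoc (α := fun _ => ℝ) (fun i : Fin k => ℓ (Fin.castLE hk i).castSucc)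
    (tailSum ℓ (k + 1) - 2 * (tailSum ν (k + 1) : ℕ))

/-- The operator
`L^ν_k = L^ν_k(ν_1, …, ν_k; ℓ_1, …, ℓ_k, |ℓ^{k+1}| - 2 |ν^{k+1}|; N - |ν^{k+1}|)`,
acting on functions of `ν_1, …, ν_d`; for `k = d` it is `L^ν_d(ν; ℓ; N)`
(see `recOp_self`). -/
def recOp {d : ℕ} (k : ℕ) (hk : k ≤ d) (ℓ : Fin (d + 1) → ℝ) (N : ℝ)
    (f : (Fin d → ℕ) → ℝ) (ν : Fin d → ℕ) : ℝ :=
  ∑ μ : Fin k → SignType with μ ≠ 0,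
    C (headIdx hk ν) (headPar hk ν ℓ) (N - (tailSum ν (k + 1) : ℕ)) μ *
      (atIndex f (shift ν μ) - f ν)

theorem recOp_self {d : ℕ} (ℓ : Fin (d + 1) → ℝ) (N : ℝ) (f : (Fin d → ℕ) → ℝ) :
    recOp d le_rfl ℓ N f = recOpFull ℓ N f := by
  funext ν
  have h1 : tailSum ν (d + 1) = 0 := by
    unfold tailSum
    apply Finset.sum_eq_zero
    intro i hi
    have := (Finset.mem_filter.mp hi).2
    omega
  have h2 : tailSum ℓ (d + 1) = ℓ (Fin.last d) := by
    unfold tailSum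
    rw [Finset.sum_eq_single (Fin.last d)]
    · intro i hi hne
      exact absurd (Fin.ext (by
        have := (Finset.mem_filter.mp hi).2
        simp only [Fin.val_last]
        omega)) hne
    · intro h
      simp at h
  have h3 : headPar le_rfl ν ℓ = ℓ := by
    funext i
    refine Fin.lastCases ?_ (fun j => ?_) i
    · simp [headPar, h1, h2]
    · simp [headPar]
  have h4 : headIdx le_rfl ν = ν := rfl
  unfold recOp recOpFull
  rw [h3, h4, h1]
  simp

/-! ### Parameters and index sets -/

/-- Generic parameters: none of the denominators in the polynomials `Q̂_ν` and in the operators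
`L^ν_k` vanishes for any index. -/
def Generic {d : ℕ} (ℓ : Fin (d + 1) → ℝ) (N : ℝ) : Prop :=
  (∀ n : ℕ, N ≠ n) ∧ (∀ (i : Fin d) (n : ℕ), ℓ i.castSucc ≠ n) ∧
    ∀ (i : Fin d) (m : ℤ), tailSum ℓ (i.val + 1) ≠ m

/-- The condition `ℓ_i ≤ N` and `ℓ_i + ℓ_j ≥ N` for `i ≠ j`. -/
def Admissible {d : ℕ} (ℓ : Fin (d + 1) → ℕ) (N : ℕ) : Prop :=
  (∀ i, ℓ i ≤ N) ∧ ∀ i j, i ≠ j → N ≤ ℓ i + ℓ j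

/-- The lattice polyhedron `V_{ℓ,N}^d`. -/
def V {d : ℕ} (ℓ : Fin (d + 1) → ℕ) (N : ℕ) : Set (Fin d → ℕ) :=
  {x | (∀ i : Fin d, x i ≤ ℓ i.castSucc) ∧ N ≤ (∑ i, x i) + ℓ (Fin.last d) ∧ ∑ i, x i ≤ N}

/-- The index set `H_{ℓ,N}^d`: `|ν| ≤ N`, `|ν| ≤ |ℓ| - N`, `ν_j ≤ ℓ_j` and
`ν_j ≤ |ℓ^{j+1}| - 2 |ν^{j+1}|`. -/
def H {d : ℕ} (ℓ : Fin (d + 1) → ℕ) (N : ℕ) : Set (Fin d → ℕ) :=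
  {ν | ∑ i, ν i ≤ N ∧ (∑ i, ν i) + N ≤ ∑ i, ℓ i ∧
    ∀ i : Fin d, ν i ≤ ℓ i.castSucc ∧
      ν i + 2 * tailSum ν (i.val + 2) ≤ tailSum ℓ (i.val + 2)}

/-- The indices with nonnegative components that occur in `(L^ν_k f)(ν)`, including `ν`. -/
def nbr {d : ℕ} (k : ℕ) (ν : Fin d → ℕ) : Set (Fin d → ℕ) :=
  {ν' | ∃ μ : Fin k → SignType, shift ν μ = fun i => (ν' i : ℤ)}

/-- The denominators `b_i^{±1}`, `b_i^0`, `1 ≤ i ≤ k`, of the coefficients of `L^ν_k` at the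
index `ν` do not vanish. -/
def Regular {d : ℕ} (k : ℕ) (ℓ : Fin (d + 1) → ℝ) (ν : Fin d → ℕ) : Prop :=
  ∀ i : Fin d, i.val < k → ∀ p : SignType, b ν ℓ i p ≠ 0

end

end HahnRec

/-!
Write `Q̂_ν = P_ν / (-N)_{|ν|}`, where `P_ν` is a product of one-variable Hahn polynomials. These
satisfy a three-term, a raising and a lowering contiguous relation, each of which holds term by term
up to a telescoping sum. Summing over the sign `μ_1` applies one of these relations to the first
factor and leaves the same kind of sum in one variable less, so a recurrence for `P_ν` follows by
induction on `d`. At `x = 0`, where every `Q̂_ν` is `1`, it gives the value of `∑ C_μ`, which turns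
the recurrence into the equation for `L_d`. The equation for `L_k` follows because `Q̂_ν` is the
product of a polynomial of the same kind in `x_1, …, x_k` and a factor that `L_k` does not change.
What holds at generic parameters extends by density and continuity to all parameters at which the
denominators do not vanish. A point of `V` at which some `Q̂_ν` with `ν` outside `H` is undefined is
a zero of the corresponding `P_ν`, and the equation survives.

At generic parameters the `Q̂_ν` are linearly independent functions of `x`, and the `L_k` act on
them by the scalars `|x_k|`. As `L_j L_k` and `L_k L_j` are finite linear combinations of shifts, it
follows that they have the same coefficients.
-/

namespace HahnRec

noncomputable section

/-! ### Contiguous relations for Hahn polynomials in one variable -/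

theorem poch_zero (a : ℝ) : poch a 0 = 1 := by simp [poch]

theorem poch_succ (a : ℝ) (k : ℕ) : poch a (k + 1) = poch a k * (a + k) := by
  simp [poch, ascPochhammer_succ_eval]

theorem continuous_poch (k : ℕ) : Continuous fun a => poch a k :=
  (ascPochhammer ℝ k).continuous

theorem mul_poch_add_one (a : ℝ) (k : ℕ) : a * poch (a + 1) k = (a + k) * poch a k := by
  have h := poch_add a 1 k
  rw [add_comm 1 k, poch_succ, poch_succ, poch_zero] at h
  push_cast at h
  linear_combination -h

theorem poch_neg_eq_zero_iff {l : ℝ} {k : ℕ} : poch (-l) k = 0 ↔ ∃ m < k, (m : ℝ) = l := by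
  rw [poch, ascPochhammer_eval_eq_zero_iff, neg_neg]

theorem poch_neg_ne_zero {l : ℝ} (h : ∀ m : ℕ, l ≠ m) (k : ℕ) : poch (-l) k ≠ 0 := fun h0 =>
  let ⟨m, _, hm⟩ := poch_neg_eq_zero_iff.1 h0
  h m hm.symm

theorem poch_neg_natCast_eq_zero_iff {n k : ℕ} : poch (-(n : ℝ)) k = 0 ↔ n < k := by
  simp [poch_neg_eq_zero_iff]

/-- `hahnReg` with an integer degree, `0` for negative degrees. The second upper parameter
`e = n - l₁ - l₂ - 1` of the hypergeometric sum takes the place of `l₂`: in this form the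
contiguous relations shift each parameter independently. -/
def hahnZ (n : ℤ) (x l e M : ℝ) : ℝ :=
  if 0 ≤ n then hahnReg n.toNat x l (n - l - e - 1) M else 0

theorem hahnReg_eq_hahnZ (n : ℕ) (x l a M : ℝ) :
    hahnReg n x l a M = hahnZ n x l (n - l - a - 1) M := by
  rw [hahnZ, if_pos n.cast_nonneg, Int.toNat_natCast]
  congr 1
  push_cast
  ring

theorem continuous_hahnZ (n : ℤ) (x l e : ℝ) : Continuous fun M => hahnZ n x l e M := by
  unfold hahnZ
  split_ifs
  · unfold hahnReg
    refine continuous_finsetSum _ fun k _ => continuous_const.mul ?_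
    exact (continuous_poch _).comp (by fun_prop)
  · exact continuous_const

/-- The `k`-th term of the sum `hahnZ n x l e M`, with `(-M + k)_{n-k}` written as
`(-M)_n / (-M)_k`. -/
def hahnTerm (n : ℤ) (x l e M : ℝ) (k : ℕ) : ℝ :=
  if 0 ≤ n then
    poch (-M) n.toNat * (poch (-n) k * poch e k * poch (-x) k /
      (poch (-l) k * poch (-M) k * (k.factorial : ℝ)))
  else 0

theorem hahnTerm_eq_zero {n : ℤ} {k : ℕ} (h : n < k) (x l e M : ℝ) :
    hahnTerm n x l e M k = 0 := by
  unfold hahnTerm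
  split_ifs with hn
  · lift n to ℕ using hn
    rw [Int.cast_natCast, poch_neg_natCast_eq_zero_iff.2 (by exact_mod_cast h)]
    simp
  · rfl

section Shifts

variable {n : ℤ} {x l e M : ℝ} {k : ℕ}

theorem hahnZ_eq_sum {K : ℕ} (hM : ∀ m : ℕ, M ≠ m) (hK : n < K) :
    hahnZ n x l e M = ∑ k ∈ Finset.range K, hahnTerm n x l e M k := by
  unfold hahnZ
  split_ifs with hn
  · lift n to ℕ using hn
    have hsub : Finset.range (n + 1) ⊆ Finset.range K := by
      simpa [Finset.range_subset_range] using hK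
    rw [← Finset.sum_subset hsub fun k _ hk => hahnTerm_eq_zero (by simpa using hk) x l e M,
      Int.toNat_natCast, hahnReg]
    refine Finset.sum_congr rfl fun k hk => ?_
    have hpoch : poch (-M) n = poch (-M) k * poch (-M + k) (n - k) := by
      rw [← poch_add, Nat.add_sub_of_le (Finset.mem_range_succ_iff.1 hk)]
    have hk0 := poch_neg_ne_zero hM k
    rw [hahnTerm, if_pos n.cast_nonneg, Int.toNat_natCast, hpoch]
    push_cast
    rw [show (n : ℝ) - l - (n - l - e - 1) - 1 = e by ring]
    field_simp
  · exact (Finset.sum_eq_zero fun k _ => if_neg hn).symm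

theorem mul_hahnTerm_degree_sub_one :
    n * (n - 1 - M) * hahnTerm (n - 1) x l e M k = (n - k) * hahnTerm n x l e M k := by
  have hk := mul_poch_add_one (-n) k
  rcases lt_trichotomy n 0 with hn | rfl | hn
  · rw [hahnTerm, hahnTerm, if_neg (by omega), if_neg (by omega), mul_zero, mul_zero]
  · simp only [Int.cast_zero, neg_zero, zero_mul, zero_add] at hk
    simp only [hahnTerm, le_refl, if_true, Int.toNat_zero, Int.cast_zero, neg_zero]
    linear_combination (-poch (-M) 0 * poch e k * poch (-x) k /
      (poch (-l) k * poch (-M) k * k.factorial)) * hk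
  · obtain ⟨m, rfl⟩ : ∃ m : ℕ, n = m + 1 := ⟨(n - 1).toNat, by omega⟩
    have hm : ((m : ℤ) + 1).toNat = m + 1 := rfl
    rw [hahnTerm, hahnTerm, if_pos (by omega), if_pos (by omega), hm, add_sub_cancel_right,
      Int.toNat_natCast, poch_succ]
    push_cast at hk ⊢
    rw [show -((m : ℝ) + 1) + 1 = -m by ring] at hk
    linear_combination (-(m - M) * poch (-M) m * poch e k * poch (-x) k /
      (poch (-l) k * poch (-M) k * k.factorial)) * hk

theorem mul_hahnTerm_upper_add_one :
    e * hahnTerm n x l (e + 1) M k = (e + k) * hahnTerm n x l e M k := by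
  unfold hahnTerm
  split_ifs
  · linear_combination (poch (-M) n.toNat * (poch (-n) k * poch (-x) k /
      (poch (-l) k * poch (-M) k * k.factorial))) * mul_poch_add_one e k
  · rw [mul_zero, mul_zero]

theorem mul_hahnTerm_lower_sub_one (hM : ∀ m : ℕ, M ≠ m) :
    (M - k) * hahnTerm n x l e (M - 1) k = (M - n) * hahnTerm n x l e M k := by
  have hM0 : M ≠ 0 := by simpa using hM 0
  have hMk : M - k ≠ 0 := sub_ne_zero.2 (hM k)
  have hpoch (j : ℕ) : poch (-(M - 1)) j = (M - j) / M * poch (-M) j := by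
    have h := mul_poch_add_one (-M) j
    rw [show -(M - 1) = -M + 1 by ring]
    field_simp
    linarith
  have hk := poch_neg_ne_zero hM k
  unfold hahnTerm
  split_ifs with hn
  · lift n to ℕ using hn
    rw [hpoch, hpoch, Int.toNat_natCast]
    push_cast
    field_simp
  · rw [mul_zero, mul_zero]

theorem mul_hahnTerm_succ (hl : ∀ m : ℕ, l ≠ m) (hM : ∀ m : ℕ, M ≠ m) :
    (k + 1) * (k - l) * (k - M) * hahnTerm n x l e M (k + 1) =
      -((n - k) * (e + k) * (k - x)) * hahnTerm n x l e M k := by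
  have hlk : -l + k ≠ 0 := fun h => hl k (by linarith)
  have hMk : -M + k ≠ 0 := fun h => hM k (by linarith)
  have hk1 : (k : ℝ) + 1 ≠ 0 := by positivity
  have hlp := poch_neg_ne_zero hl k
  have hMp := poch_neg_ne_zero hM k
  unfold hahnTerm
  split_ifs
  · simp only [poch_succ, Nat.factorial_succ]
    push_cast
    field_simp
    ring
  · rw [mul_zero, mul_zero]

end Shifts

section Contiguous

variable {n : ℕ} {x l e M : ℝ}

theorem raise_coeff_identity {n e k : ℝ} (M : ℝ) (h0 : e + n + 1 ≠ 0) (h1 : e + n ≠ 0)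
    (h2 : e + n - 1 ≠ 0) :
    -((e + 1 + k) * (e + k) * (M - n)) / ((e + n + 1) * (e + n)) +
      (n - 1 - e - 2 * M) * (n - k) * (e + k) / ((e + n + 1) * (e + n - 1)) -
      (e + M) * (n - k) * (n - 1 - k) / ((e + n - 1) * (e + n)) = -(M - k) := by
  field_simp
  ring

theorem hahnTerm_raise {k : ℕ} (he : ∀ m : ℤ, e ≠ m) (hM : ∀ m : ℕ, M ≠ m) :
    -(e * (e + 1)) / ((e + n + 1) * (e + n)) * hahnTerm n x l (e + 2) (M - 1) k -
      (n - 1 - e - 2 * M) * n * e / ((e + n + 1) * (e + n - 1)) *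
        hahnTerm (n - 1) x l (e + 1) (M - 1) k +
      (e + M) * (n - M - 1) * n * (n - 1) / ((e + n - 1) * (e + n)) *
        hahnTerm (n - 2) x l e (M - 1) k =
    -hahnTerm n x l e M k := by
  obtain ⟨w, hw⟩ : ∃ w, hahnTerm n x l e M k = (M - k) * w :=
    ⟨_, (mul_div_cancel₀ _ (sub_ne_zero.2 (hM k))).symm⟩
  have term : hahnTerm n x l e (M - 1) k = (M - n) * w := by
    apply mul_left_cancel₀ (sub_ne_zero.2 (hM k))
    linear_combination mul_hahnTerm_lower_sub_one (n := n) hM + (M - n) * hw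
  have term_zero : n * hahnTerm (n - 1) x l e (M - 1) k = -(n - k) * w := by
    have h := mul_hahnTerm_degree_sub_one (n := n) (x := x) (l := l) (e := e) (M := M - 1) (k := k)
    apply mul_left_cancel₀ (sub_ne_zero.2 (hM n))
    push_cast at h
    linear_combination -h - (n - k) * term
  have term_neg : n * (n - 1) * (n - M - 1) * hahnTerm (n - 2) x l e (M - 1) k =
      -((n - k) * (n - 1 - k)) * w := by
    have h := mul_hahnTerm_degree_sub_one (n := n - 1) (x := x) (l := l) (e := e) (M := M - 1)
      (k := k)
    rw [show (n : ℤ) - 1 - 1 = n - 2 by ring] at h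
    push_cast at h
    linear_combination n * h + (n - 1 - k) * term_zero
  have upper (m : ℤ) (e : ℝ) := mul_hahnTerm_upper_add_one (n := m) (x := x) (l := l) (e := e)
    (M := M - 1) (k := k)
  have upper_two := upper n (e + 1)
  rw [add_assoc, one_add_one_eq_two] at upper_two
  have id := raise_coeff_identity (n := n) (e := e) (k := k) M
    (fun h => he (-(n + 1)) (by push_cast; linarith)) (fun h => he (-n) (by push_cast; linarith))
    (fun h => he (1 - n) (by push_cast; linarith))
  linear_combination hw -
    (e * upper_two + (e + 1 + k) * upper n e + (e + 1 + k) * (e + k) * term) /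
      ((e + n + 1) * (e + n)) -
    (n - 1 - e - 2 * M) / ((e + n + 1) * (e + n - 1)) *
      (n * upper (n - 1) e + (e + k) * term_zero) +
    (e + M) / ((e + n - 1) * (e + n)) * term_neg + w * id

theorem hahnZ_raise (he : ∀ m : ℤ, e ≠ m) (hM : ∀ m : ℕ, M ≠ m) :
    -(e * (e + 1)) / ((e + n + 1) * (e + n)) * hahnZ n x l (e + 2) (M - 1) -
      (n - 1 - e - 2 * M) * n * e / ((e + n + 1) * (e + n - 1)) *
        hahnZ (n - 1) x l (e + 1) (M - 1) +
      (e + M) * (n - M - 1) * n * (n - 1) / ((e + n - 1) * (e + n)) *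
        hahnZ (n - 2) x l e (M - 1) =
    -hahnZ n x l e M := by
  have hM1 : ∀ m : ℕ, M - 1 ≠ m := fun m h => hM (m + 1) (by push_cast; linarith)
  rw [hahnZ_eq_sum hM1 (K := n + 1) (by omega), hahnZ_eq_sum hM1 (K := n + 1) (by omega),
    hahnZ_eq_sum hM1 (K := n + 1) (by omega), hahnZ_eq_sum hM (K := n + 1) (by omega)]
  simp only [Finset.mul_sum, ← Finset.sum_sub_distrib, ← Finset.sum_add_distrib,
    ← Finset.sum_neg_distrib, hahnTerm_raise he hM]

theorem three_term_coeff_identity {n e k : ℝ} (l M : ℝ) (h0 : e + n + 1 ≠ 0) (h1 : e + n ≠ 0)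
    (h2 : e + n - 1 ≠ 0) (hk : e - 1 + k ≠ 0) :
    -((l - n) * (e + k) * (n + 1) * (n - M)) / ((e + n + 1) * (e + n)) +
      (n - 1 - e - 2 * M) * (n * e + (n - l - 1 - e) * (n + 1 - e) / 2) * (n + 1 - k) /
        ((e + n + 1) * (e + n - 1)) -
      (e + M) * (l + e) / ((e + n - 1) * (e + n)) *
        ((n - k) * (n + 1 - k) * (e - 1) / (e - 1 + k)) =
    (k - M + (n - l - 1 - e) / 2) * (n + 1 - k) + k * (k - 1 - l) * (k - 1 - M) / (e - 1 + k) := by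
  field_simp
  ring

/-- Writing all terms as multiples of one `w` reduces the three-term relation to an identity of
rational functions. -/
theorem exists_hahnTerm_three_term_eq_mul (he : ∀ m : ℤ, e ≠ m) (hM : ∀ m : ℕ, M ≠ m) (k : ℕ) :
    ∃ w : ℝ,
      hahnTerm (n + 1) x l e M k = (n + 1) * (n - M) * w ∧
      hahnTerm n x l e M k = (n + 1 - k) * w ∧
      e * hahnTerm (n + 1) x l (e + 1) M k = (e + k) * (n + 1) * (n - M) * w ∧
      n * (n - M - 1) * hahnTerm (n - 1) x l (e - 1) M k =
        (n - k) * (n + 1 - k) * (e - 1) / (e - 1 + k) * w := by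
  have hne : ((n : ℝ) + 1) * (n - M) ≠ 0 :=
    mul_ne_zero (by positivity) (sub_ne_zero.2 (hM n).symm)
  have hek1 : e - 1 + k ≠ 0 := fun h => he (1 - k) (by push_cast; linarith)
  obtain ⟨w, hw⟩ : ∃ w : ℝ, hahnTerm (n + 1) x l e M k = (n + 1) * (n - M) * w :=
    ⟨_, (mul_div_cancel₀ _ hne).symm⟩
  have term : hahnTerm n x l e M k = (n + 1 - k) * w := by
    have h := mul_hahnTerm_degree_sub_one (n := n + 1) (x := x) (l := l) (e := e) (M := M) (k := k)
    rw [add_sub_cancel_right, hw] at h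
    push_cast at h
    apply mul_left_cancel₀ hne
    linear_combination h
  refine ⟨w, hw, term, ?_, ?_⟩
  · have h := mul_hahnTerm_upper_add_one (n := n + 1) (x := x) (l := l) (e := e) (M := M) (k := k)
    linear_combination h + (e + k) * hw
  · have h := mul_hahnTerm_degree_sub_one (n := n) (x := x) (l := l) (e := e) (M := M) (k := k)
    have h' := mul_hahnTerm_upper_add_one (n := n - 1) (x := x) (l := l) (e := e - 1) (M := M)
      (k := k)
    rw [sub_add_cancel] at h'
    push_cast at h
    field_simp
    linear_combination -n * (n - M - 1) * h' + (e - 1) * h + (e - 1) * (n - k) * term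

theorem exists_telescoping_three_term (hl : ∀ m : ℕ, l ≠ m) (he : ∀ m : ℤ, e ≠ m)
    (hM : ∀ m : ℕ, M ≠ m) :
    ∃ G : ℕ → ℝ, G 0 = 0 ∧ (∀ k, n + 1 < k → G k = 0) ∧ ∀ k : ℕ,
      -((l - n) * e) / ((e + n + 1) * (e + n)) * hahnTerm (n + 1) x l (e + 1) M k +
        (n - 1 - e - 2 * M) * (n * e + (n - l - 1 - e) * (n + 1 - e) / 2) /
          ((e + n + 1) * (e + n - 1)) * hahnTerm n x l e M k -
        (e + M) * (n - M - 1) * n * (l + e) / ((e + n - 1) * (e + n)) *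
          hahnTerm (n - 1) x l (e - 1) M k =
      (x - M + (n - l - 1 - e) / 2) * hahnTerm n x l e M k + (G (k + 1) - G k) := by
  have hne : ((n : ℝ) + 1) * (n - M) ≠ 0 :=
    mul_ne_zero (by positivity) (sub_ne_zero.2 (hM n).symm)
  choose w hw term term_pos term_neg using
    exists_hahnTerm_three_term_eq_mul (n := n) (x := x) (l := l) he hM
  refine ⟨fun k => -(k * (k - 1 - l) * (k - 1 - M)) / (e - 1 + k) * w k, by simp, ?_, ?_⟩
  · intro k hk
    have : w k = 0 := by
      simpa [hahnTerm_eq_zero (n := n + 1) (k := k) (by exact_mod_cast hk), hne] using hw k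
    simp [this]
  intro k
  have hek : e + k ≠ 0 := fun h => he (-k) (by push_cast; linarith)
  have hek1 : e - 1 + k ≠ 0 := fun h => he (1 - k) (by push_cast; linarith)
  have next : (k + 1) * (k - l) * (k - M) / (e + k) * w (k + 1) =
      -((n + 1 - k) * (k - x)) * w k := by
    have h := mul_hahnTerm_succ (n := n + 1) (x := x) (e := e) (k := k) hl hM
    rw [hw, hw] at h
    push_cast at h
    field_simp
    apply mul_left_cancel₀ hne
    linear_combination h
  have id := three_term_coeff_identity (n := n) (e := e) (k := k) l M
    (fun h => he (-(n + 1)) (by push_cast; linarith)) (fun h => he (-n) (by push_cast; linarith))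
    (fun h => he (1 - n) (by push_cast; linarith)) hek1
  push_cast
  rw [show e - 1 + ((k : ℝ) + 1) = e + k by ring]
  linear_combination
    (-(l - n) / ((e + n + 1) * (e + n))) * term_pos k +
    ((n - 1 - e - 2 * M) * (n * e + (n - l - 1 - e) * (n + 1 - e) / 2) /
      ((e + n + 1) * (e + n - 1)) - (x - M + (n - l - 1 - e) / 2)) * term k -
    (e + M) * (l + e) / ((e + n - 1) * (e + n)) * term_neg k + next + w k * id

theorem hahnZ_three_term (hl : ∀ m : ℕ, l ≠ m) (he : ∀ m : ℤ, e ≠ m) (hM : ∀ m : ℕ, M ≠ m) :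
    -((l - n) * e) / ((e + n + 1) * (e + n)) * hahnZ (n + 1) x l (e + 1) M +
      (n - 1 - e - 2 * M) * (n * e + (n - l - 1 - e) * (n + 1 - e) / 2) /
        ((e + n + 1) * (e + n - 1)) * hahnZ n x l e M -
      (e + M) * (n - M - 1) * n * (l + e) / ((e + n - 1) * (e + n)) *
        hahnZ (n - 1) x l (e - 1) M =
    (x - M + (n - l - 1 - e) / 2) * hahnZ n x l e M := by
  obtain ⟨G, G_zero, G_top, hG⟩ := exists_telescoping_three_term (n := n) (x := x) hl he hM
  rw [hahnZ_eq_sum hM (K := n + 2) (by omega), hahnZ_eq_sum hM (K := n + 2) (by omega),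
    hahnZ_eq_sum hM (K := n + 2) (by omega)]
  simp only [Finset.mul_sum, ← Finset.sum_sub_distrib, ← Finset.sum_add_distrib, hG]
  rw [Finset.sum_add_distrib, Finset.sum_range_sub, G_zero, G_top _ (by omega), sub_zero, add_zero]

theorem lower_coeff_identity {n e k : ℝ} (l M : ℝ) (h0 : e + n + 1 ≠ 0) (h1 : e + n ≠ 0)
    (h2 : e + n - 1 ≠ 0) (hk1 : e - 1 + k ≠ 0) (hk2 : e - 2 + k ≠ 0) :
    (l - n) * (l - n - 1) * (n + 1) * (n + 2) * (n - M) / ((e + n + 1) * (e + n)) -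
      (n - 1 - e - 2 * M) * (l - n) * (l + e) / ((e + n + 1) * (e + n - 1)) *
        ((n + 1) * (n + 2 - k) * (e - 1) / (e - 1 + k)) -
      (e + M) * (l + e) * (l + e - 1) / ((e + n - 1) * (e + n)) *
        ((n + 1 - k) * (n + 2 - k) * (e - 1) * (e - 2) / (e - 1 + k) / (e - 2 + k)) =
    -(M - n + l + e - k) * (n + 2 - k) * (n + 1 - k) +
      (2 * k - 2 * M + n - l - 2 - e) * (n + 2 - k) * k * (k - 1 - l) / (e - 1 + k) +
      k * (k - 1) * (k - 1 - l) * (k - 2 - l) * (k - 2 - M) / (e - 1 + k) / (e - 2 + k) := by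
  field_simp
  ring

theorem exists_hahnTerm_degree_eq_mul (hM : ∀ m : ℕ, M ≠ m) (k : ℕ) :
    ∃ w : ℝ,
      hahnTerm (n + 2) x l e M k = (n + 1) * (n + 2) * (n - M) * (n + 1 - M) * w ∧
      hahnTerm (n + 1) x l e M k = (n + 1) * (n - M) * (n + 2 - k) * w ∧
      hahnTerm n x l e M k = (n + 1 - k) * (n + 2 - k) * w := by
  have hnM : (n : ℝ) - M ≠ 0 := sub_ne_zero.2 (hM n).symm
  have hnM1 : (n : ℝ) + 1 - M ≠ 0 := sub_ne_zero.2 (mod_cast (hM (n + 1)).symm)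
  have degree (m : ℤ) := mul_hahnTerm_degree_sub_one (n := m) (x := x) (l := l) (e := e)
    (M := M) (k := k)
  obtain ⟨w, hw⟩ : ∃ w,
      hahnTerm (n + 2) x l e M k = (n + 1) * (n + 2) * (n - M) * (n + 1 - M) * w :=
    ⟨_, (mul_div_cancel₀ _ (by positivity)).symm⟩
  have term_one : hahnTerm (n + 1) x l e M k = (n + 1) * (n - M) * (n + 2 - k) * w := by
    have h := degree (n + 2)
    rw [show (n : ℤ) + 2 - 1 = n + 1 by ring, hw] at h
    push_cast at h
    apply mul_left_cancel₀ (mul_ne_zero (a := (n : ℝ) + 2) (by positivity) hnM1)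
    linear_combination h
  have h := degree (n + 1)
  rw [add_sub_cancel_right, term_one] at h
  push_cast at h
  refine ⟨w, hw, term_one, mul_left_cancel₀ (mul_ne_zero (a := (n : ℝ) + 1) (by positivity) hnM) ?_⟩
  linear_combination h

theorem exists_hahnTerm_lower_eq_mul (he : ∀ m : ℤ, e ≠ m) (hM : ∀ m : ℤ, M ≠ m) (k : ℕ) :
    ∃ w : ℝ,
      hahnTerm (n + 2) x l e M k = (n + 1) * (n + 2) * (n - M) * (n + 1 - M) * w ∧
      hahnTerm n x l e M k = (n + 1 - k) * (n + 2 - k) * w ∧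
      hahnTerm (n + 2) x l e (M + 1) k = -((M + 1 - k) * (n + 1) * (n + 2) * (n - M)) * w ∧
      hahnTerm (n + 1) x l (e - 1) (M + 1) k =
        -(M + 1 - k) * ((n + 1) * (n + 2 - k) * (e - 1) / (e - 1 + k)) * w ∧
      (n - M - 1) * hahnTerm n x l (e - 2) (M + 1) k =
        -(M + 1 - k) * ((n + 1 - k) * (n + 2 - k) * (e - 1) * (e - 2) /
          (e - 1 + k) / (e - 2 + k)) * w := by
  have hM1 : ∀ m : ℕ, M + 1 ≠ m := fun m h => hM (m - 1) (by push_cast; linarith)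
  have hnM : (n : ℝ) - M ≠ 0 := sub_ne_zero.2 fun h => hM n h.symm
  have hnM1 : (n : ℝ) + 1 - M ≠ 0 := sub_ne_zero.2 fun h => hM (n + 1) (by push_cast; linarith)
  have hek1 : e - 1 + k ≠ 0 := fun h => he (1 - k) (by push_cast; linarith)
  have hek2 : e - 2 + k ≠ 0 := fun h => he (2 - k) (by push_cast; linarith)
  have lower (m : ℤ) : (M + 1 - k) * hahnTerm m x l e M k =
      (M + 1 - m) * hahnTerm m x l e (M + 1) k := by
    simpa using mul_hahnTerm_lower_sub_one (n := m) (x := x) (l := l) (e := e) (k := k) hM1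
  have upper (m : ℤ) (e : ℝ) := mul_hahnTerm_upper_add_one (n := m) (x := x) (l := l) (e := e)
    (M := M + 1) (k := k)
  obtain ⟨w, hw, term_one, term⟩ :=
    exists_hahnTerm_degree_eq_mul (n := n) (x := x) (l := l) (e := e) (fun m => mod_cast hM m) k
  refine ⟨w, hw, term, ?_, ?_, ?_⟩
  · have h := lower (n + 2)
    push_cast at h
    apply mul_left_cancel₀ hnM1
    linear_combination h - (M + 1 - k) * hw
  · have h := lower (n + 1)
    have h' := upper (n + 1) (e - 1)
    rw [sub_add_cancel] at h'
    push_cast at h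
    field_simp
    apply mul_left_cancel₀ hnM
    linear_combination -(n - M) * h' + (e - 1) * h - (e - 1) * (M + 1 - k) * term_one
  · have h := lower n
    have h' := upper n (e - 1)
    have h'' := upper n (e - 2)
    rw [sub_add_cancel] at h'
    rw [show e - 2 + 1 = e - 1 by ring] at h''
    push_cast at h
    field_simp
    linear_combination -(n - M - 1) * ((e - 1 + k) * h'' + (e - 2) * h') -
      (e - 1) * (e - 2) * (-h + (M + 1 - k) * term)

theorem exists_telescoping_lower (hl : ∀ m : ℕ, l ≠ m) (he : ∀ m : ℤ, e ≠ m)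
    (hM : ∀ m : ℤ, M ≠ m) :
    ∃ G : ℕ → ℝ, G 0 = 0 ∧ (∀ k, n + 2 < k → G k = 0) ∧ ∀ k : ℕ,
      -((l - n) * (l - n - 1)) / ((e + n + 1) * (e + n)) * hahnTerm (n + 2) x l e (M + 1) k +
        (n - 1 - e - 2 * M) * (l - n) * (l + e) / ((e + n + 1) * (e + n - 1)) *
          hahnTerm (n + 1) x l (e - 1) (M + 1) k +
        (e + M) * (n - M - 1) * (l + e) * (l + e - 1) / ((e + n - 1) * (e + n)) *
          hahnTerm n x l (e - 2) (M + 1) k =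
      -((l + e - n + M - x) * (M - x + 1)) * hahnTerm n x l e M k + (G (k + 1) - G k) := by
  choose w hw term term_two term_one term_zero using
    exists_hahnTerm_lower_eq_mul (n := n) (x := x) (l := l) he hM
  refine ⟨fun k => ((k + x - 2 * M + n - l - 2 - e) * (n + 2 - k) *
      (k * (k - 1 - l) * (k - 1 - M)) / (e - 1 + k) + k * (k - 1) * (k - 1 - l) * (k - 2 - l) *
      (k - 1 - M) * (k - 2 - M) / (e - 1 + k) / (e - 2 + k)) * w k, by simp, ?_, ?_⟩
  · intro k hk
    have hcoeff : ((n : ℝ) + 1 - k) * (n + 2 - k) ≠ 0 := by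
      have : ((n + 2 : ℕ) : ℝ) < k := Nat.cast_lt.2 hk
      push_cast at this
      exact (mul_pos_of_neg_of_neg (by linarith) (by linarith)).ne'
    have : w k = 0 := by
      simpa [hahnTerm_eq_zero (n := n) (k := k) (by omega), hcoeff] using term k
    simp [this]
  intro k
  have hek : e + k ≠ 0 := fun h => he (-k) (by push_cast; linarith)
  have next : (k + 1) * (k - l) * (k - M) / (e + k) * w (k + 1) =
      -((n + 2 - k) * (k - x)) * w k := by
    have hcoeff : ((n : ℝ) + 1) * (n + 2) * (n - M) * (n + 1 - M) ≠ 0 :=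
      mul_ne_zero (mul_ne_zero (by positivity) (sub_ne_zero.2 fun h => hM n h.symm))
        (sub_ne_zero.2 fun h => hM (n + 1) (by push_cast; linarith))
    have h := mul_hahnTerm_succ (n := n + 2) (x := x) (e := e) (k := k) hl
      fun m => by exact_mod_cast hM m
    rw [hw, hw] at h
    push_cast at h
    field_simp
    apply mul_left_cancel₀ hcoeff
    linear_combination h
  have id := lower_coeff_identity (n := n) (e := e) (k := k) l M
    (fun h => he (-(n + 1)) (by push_cast; linarith)) (fun h => he (-n) (by push_cast; linarith))
    (fun h => he (1 - n) (by push_cast; linarith))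
    (fun h => he (1 - k) (by push_cast; linarith)) (fun h => he (2 - k) (by push_cast; linarith))
  push_cast
  rw [show e - 1 + ((k : ℝ) + 1) = e + k by ring, show e - 2 + ((k : ℝ) + 1) = e - 1 + k by ring]
  linear_combination
    -((l - n) * (l - n - 1)) / ((e + n + 1) * (e + n)) * term_two k +
    (n - 1 - e - 2 * M) * (l - n) * (l + e) / ((e + n + 1) * (e + n - 1)) * term_one k +
    (e + M) * (l + e) * (l + e - 1) / ((e + n - 1) * (e + n)) * term_zero k +
    (l + e - n + M - x) * (M - x + 1) * term k + (M + 1 - k) * w k * id -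
    ((k + 1 + x - 2 * M + n - l - 2 - e) * (n + 1 - k) +
      k * (k - 1 - l) * (k - 1 - M) / (e - 1 + k)) * next

theorem hahnZ_lower (hl : ∀ m : ℕ, l ≠ m) (he : ∀ m : ℤ, e ≠ m) (hM : ∀ m : ℤ, M ≠ m) :
    -((l - n) * (l - n - 1)) / ((e + n + 1) * (e + n)) * hahnZ (n + 2) x l e (M + 1) +
      (n - 1 - e - 2 * M) * (l - n) * (l + e) / ((e + n + 1) * (e + n - 1)) *
        hahnZ (n + 1) x l (e - 1) (M + 1) +
      (e + M) * (n - M - 1) * (l + e) * (l + e - 1) / ((e + n - 1) * (e + n)) *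
        hahnZ n x l (e - 2) (M + 1) =
    -((l + e - n + M - x) * (M - x + 1)) * hahnZ n x l e M := by
  have hM0 : ∀ m : ℕ, M ≠ m := fun m => by exact_mod_cast hM m
  have hM1 : ∀ m : ℕ, M + 1 ≠ m := fun m h => hM (m - 1) (by push_cast; linarith)
  obtain ⟨G, G_zero, G_top, hG⟩ := exists_telescoping_lower (n := n) (x := x) hl he hM
  rw [hahnZ_eq_sum hM1 (K := n + 3) (by omega), hahnZ_eq_sum hM1 (K := n + 3) (by omega),
    hahnZ_eq_sum hM1 (K := n + 3) (by omega), hahnZ_eq_sum hM0 (K := n + 3) (by omega)]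
  simp only [Finset.mul_sum, ← Finset.sum_add_distrib, hG]
  rw [Finset.sum_add_distrib, Finset.sum_range_sub, G_zero, G_top _ (by omega), sub_zero, add_zero]

end Contiguous

/-- The coefficient `B_0^{0,q}` for the products `hahnP`, which lack the factor
`1 / (-N)_{|ν|}` of `hahnQ`; `T`, `L` stand for `|ν|`, `|ℓ|`. -/
def endCoeff (T L N : ℝ) : SignType → ℝ
  | .zero => -N + L / 2
  | .pos => -1
  | .neg => (T - L + N - 1) * (T - N - 1)

/-- The coefficient `B_i^{p,q}` as a function of `n = ν_i`, `l = ℓ_i` and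
`a = |ℓ^{i+1}| - 2|ν^{i+1}|`. -/
def stepCoeff (n l a : ℝ) : SignType → SignType → ℝ
  | .zero, .zero => n * (n - l - a - 1) + a * (l + a + 2) / 2
  | .zero, .pos => -n * (n - l - a - 1)
  | .zero, .neg => (l - n) * (n - a - 1)
  | .pos, .zero => (l - n) * (n - l - a - 1)
  | .neg, .zero => -n * (n - a - 1)
  | .pos, .pos => (n - l - a - 1) * (n - l - a)
  | .neg, .pos => n * (n - 1)
  | .pos, .neg => (l - n) * (l - n - 1)
  | .neg, .neg => (n - a - 1) * (n - a - 2)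

/-- The denominator `b_i^p` as a function of `s_i = 2|ν^i| - |ℓ^i|`. -/
def stepDen (s : ℝ) : SignType → ℝ
  | .zero => s * (s - 2) / 2
  | .pos => s * (s - 1)
  | .neg => (s - 2) * (s - 1)

theorem sum_signType (f : SignType → ℝ) : ∑ p, f p = f 1 + f 0 + f (-1) := by
  rw [SignType.univ_eq, Finset.sum_insert (by decide), Finset.sum_insert (by decide),
    Finset.sum_singleton]
  ring

theorem continuous_endCoeff (T : ℝ) (q : SignType) :
    Continuous fun p : ℝ × ℝ => endCoeff T p.1 p.2 q := by
  cases q <;> simp only [endCoeff] <;> fun_prop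

theorem hahnReg_contiguous_of_irrational (n : ℕ) (x : ℝ) {l a M : ℝ} (hl : ∀ m : ℕ, l ≠ m)
    (hla : ∀ m : ℤ, l + a ≠ m) (hM : Irrational M) (q : SignType) :
    ∑ p : SignType, endCoeff n (l + a) M p * (stepCoeff n l a p q / stepDen (2 * n - l - a) p) *
        hahnZ (n + (p - q)) x l (n - l - a - 1 + (p + q)) (M - (q : ℝ)) =
      endCoeff 0 a (M - x) q * hahnReg n x l a M := by
  rw [hahnReg_eq_hahnZ]
  obtain ⟨e, rfl⟩ : ∃ e, a = n - l - 1 - e := ⟨n - l - 1 - a, by ring⟩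
  have he : ∀ m : ℤ, e ≠ m := fun m h => hla (n - 1 - m) (by push_cast; linarith)
  rw [sum_signType, show (n : ℝ) - l - (n - l - 1 - e) - 1 = e by ring,
    show 2 * (n : ℝ) - l - (n - l - 1 - e) = e + n + 1 by ring]
  have two : (-1 : ℤ) - 1 = -2 := rfl
  have two' : (-1 : ℝ) - 1 = -2 := by norm_num
  cases q
  · have h := hahnZ_three_term (x := x) (n := n) hl he hM.ne_nat
    simp only [SignType.zero_eq_zero, SignType.coe_zero, SignType.coe_one, SignType.coe_neg_one,
      sub_zero, add_zero, ← sub_eq_add_neg]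
    simp only [endCoeff, stepCoeff, stepDen, div_div_eq_mul_div]
    linear_combination h
  · have h := hahnZ_lower (x := x) (n := n) hl he hM.ne_int
    simp only [SignType.neg_eq_neg_one, SignType.coe_zero, SignType.coe_one, SignType.coe_neg_one,
      sub_neg_eq_add, zero_add, neg_add_cancel, add_neg_cancel, add_zero, one_add_one_eq_two,
      ← sub_eq_add_neg, zero_sub, two']
    simp only [endCoeff, stepCoeff, stepDen, div_div_eq_mul_div]
    linear_combination h
  · have h := hahnZ_raise (x := x) (l := l) (n := n) he hM.ne_nat
    simp only [SignType.pos_eq_one, SignType.coe_zero, SignType.coe_one, SignType.coe_neg_one,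
      sub_self, zero_add, neg_add_cancel, add_zero, one_add_one_eq_two, two,
      ← sub_eq_add_neg, zero_sub]
    simp only [endCoeff, stepCoeff, stepDen, div_div_eq_mul_div]
    linear_combination h

theorem hahnReg_contiguous (n : ℕ) (x : ℝ) {l a : ℝ} (M : ℝ) (hl : ∀ m : ℕ, l ≠ m)
    (hla : ∀ m : ℤ, l + a ≠ m) (q : SignType) :
    ∑ p : SignType, endCoeff n (l + a) M p * (stepCoeff n l a p q / stepDen (2 * n - l - a) p) *
        hahnZ (n + (p - q)) x l (n - l - a - 1 + (p + q)) (M - q) =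
      endCoeff 0 a (M - x) q * hahnReg n x l a M := by
  revert M
  rw [← funext_iff]
  refine Continuous.ext_on dense_irrational ?_ ?_ fun M hM =>
    hahnReg_contiguous_of_irrational n x hl hla hM q
  · exact continuous_finsetSum _ fun p _ => (((continuous_endCoeff n p).comp
      (Continuous.prodMk_right _)).mul continuous_const).mul
      ((continuous_hahnZ _ x l _).comp (continuous_sub_right _))
  · simp only [hahnReg_eq_hahnZ]
    exact ((continuous_endCoeff 0 q).comp (f := fun M => (a, M - x)) (by fun_prop)).mul
      (continuous_hahnZ _ x l _)

/-! ### Peeling off the first coordinate -/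

section Sums

variable {M : Type} [AddCommMonoid M]

theorem tailSum_eq_sum_ite {n : ℕ} (y : Fin n → M) (j : ℕ) :
    tailSum y j = ∑ i : Fin n, if j ≤ i.val + 1 then y i else 0 := by
  rw [tailSum, Finset.sum_filter]

theorem headSum_eq_sum_ite {n : ℕ} (y : Fin n → M) (j : ℕ) :
    headSum y j = ∑ i : Fin n, if i.val + 1 ≤ j then y i else 0 := by
  rw [headSum, Finset.sum_filter]

theorem headSum_zero {n : ℕ} (y : Fin n → M) : headSum y 0 = 0 := by
  simp [headSum_eq_sum_ite]

theorem headSum_succ {n : ℕ} (y : Fin (n + 1) → M) (j : ℕ) :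
    headSum y (j + 1) = y 0 + headSum (Fin.tail y) j := by
  simp [headSum_eq_sum_ite, Fin.sum_univ_succ, Fin.tail]

theorem tailSum_one {n : ℕ} (y : Fin n → M) : tailSum y 1 = ∑ i, y i := by
  simp [tailSum_eq_sum_ite]

theorem tailSum_add_two {n : ℕ} (y : Fin (n + 1) → M) (j : ℕ) :
    tailSum y (j + 2) = tailSum (Fin.tail y) (j + 1) := by
  simp [tailSum_eq_sum_ite, Fin.sum_univ_succ, Fin.tail]

theorem tailSum_two {n : ℕ} (y : Fin (n + 1) → M) : tailSum y 2 = ∑ i, Fin.tail y i := by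
  rw [tailSum_add_two y 0, tailSum_one]

theorem sum_eq_zero_add_tailSum_two {n : ℕ} (y : Fin (n + 1) → M) :
    ∑ i, y i = y 0 + tailSum y 2 := by
  rw [tailSum_two, Fin.sum_univ_succ]
  rfl

end Sums

theorem ext_cons_one {d : ℕ} (p : SignType) (μ : Fin d → SignType) :
    ext (Fin.cons p μ : Fin (d + 1) → SignType) 1 = p := by
  simp [ext]

theorem ext_cons_add_two {d : ℕ} (p : SignType) (μ : Fin d → SignType) (j : ℕ) :
    ext (Fin.cons p μ : Fin (d + 1) → SignType) (j + 2) = ext μ (j + 1) := by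
  unfold ext
  by_cases h : j + 1 ≤ d
  · rw [dif_pos ⟨by omega, by omega⟩, dif_pos ⟨by omega, h⟩]
    exact Fin.cons_succ (α := fun _ => SignType) p μ ⟨j, by omega⟩
  · rw [dif_neg (by omega), dif_neg (by omega)]

theorem b_eq_stepDen {d : ℕ} (ν : Fin d → ℕ) (ℓ : Fin (d + 1) → ℝ) (i : Fin d) (p : SignType) :
    b ν ℓ i p = stepDen (2 * (tailSum ν (i.val + 1) : ℕ) - tailSum ℓ (i.val + 1)) p := by
  cases p <;> rfl

section Cons

variable {d : ℕ} (ν : Fin (d + 1) → ℕ) (ℓ : Fin (d + 2) → ℝ)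

theorem b_succ (i : Fin d) (p : SignType) : b ν ℓ i.succ p = b (Fin.tail ν) (Fin.tail ℓ) i p := by
  simp only [b_eq_stepDen, Fin.val_succ]
  rw [tailSum_add_two, tailSum_add_two]

theorem b_zero (p : SignType) :
    b ν ℓ 0 p = stepDen (2 * ν 0 - ℓ 0 - (tailSum ℓ 2 - 2 * (tailSum ν 2 : ℕ))) p := by
  rw [b_eq_stepDen]
  congr 1
  simp only [Fin.val_zero, zero_add, tailSum_one, sum_eq_zero_add_tailSum_two]
  push_cast
  ring

theorem B_succ (i : Fin d) (p q : SignType) :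
    B ν ℓ i.succ p q = B (Fin.tail ν) (Fin.tail ℓ) i p q := by
  simp only [B, Fin.val_succ, tailSum_add_two]
  rfl

theorem B_zero (p q : SignType) :
    B ν ℓ 0 p q = stepCoeff (ν 0) (ℓ 0) (tailSum ℓ 2 - 2 * (tailSum ν 2 : ℕ)) p q := by
  simp only [B, Fin.val_zero, zero_add, tailSum_one, sum_eq_zero_add_tailSum_two,
    Fin.castSucc_zero]
  cases p <;> cases q <;> simp only [stepCoeff] <;> push_cast <;> ring

theorem shift_cons_zero (p : SignType) (μ : Fin d → SignType) :
    shift ν (Fin.cons p μ : Fin (d + 1) → SignType) 0 = ν 0 + ((p : ℤ) - (ext μ 1 : ℤ)) := by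
  simp only [shift, Fin.val_zero, zero_add, ext_cons_one]
  rw [show (2 : ℕ) = 0 + 2 from rfl, ext_cons_add_two]

theorem shift_cons_succ (p : SignType) (μ : Fin d → SignType) (i : Fin d) :
    shift ν (Fin.cons p μ : Fin (d + 1) → SignType) i.succ = shift (Fin.tail ν) μ i := by
  simp only [shift, Fin.val_succ, ext_cons_add_two]
  rfl

end Cons

theorem sum_shift {d : ℕ} (ν : Fin d → ℕ) (μ : Fin d → SignType) :
    ∑ i, shift ν μ i = ∑ i, (ν i : ℤ) + (ext μ 1 : ℤ) := by
  induction d with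
  | zero => simp [ext]
  | succ d ih =>
    obtain ⟨p, μ, rfl⟩ : ∃ p μ', μ = Fin.cons p μ' := ⟨μ 0, Fin.tail μ, (Fin.cons_self_tail μ).symm⟩
    simp only [Fin.sum_univ_succ, shift_cons_zero, ext_cons_one, shift_cons_succ, ih, Fin.tail]
    ring

/-- The product of the one-variable Hahn polynomials in `hahnQ`, without the factor
`1 / (-N)_{|ν|}`. -/
def hahnP {d : ℕ} (ν : Fin d → ℕ) (x : Fin d → ℝ) (ℓ : Fin (d + 1) → ℝ) (N : ℝ) : ℝ :=
  ∏ i : Fin d,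
    hahnReg (ν i) (x i) (ℓ i.castSucc)
      (tailSum ℓ (i.val + 2) - 2 * (tailSum ν (i.val + 2) : ℕ))
      (N - headSum x i.val - (tailSum ν (i.val + 2) : ℕ))

theorem hahnQ_eq {d : ℕ} (ν : Fin d → ℕ) (x : Fin d → ℝ) (ℓ : Fin (d + 1) → ℝ) (N : ℝ) :
    hahnQ ν x ℓ N = 1 / poch (-N) (∑ i, ν i) * hahnP ν x ℓ N := rfl

/-- The product `∏_{i=1}^d B_i^{μ_i, μ_{i+1}} / ∏_{i=1}^d b_i^{μ_i}`, the part of `C_μ` that does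
not involve `N`. -/
def stepProd {d : ℕ} (ν : Fin d → ℕ) (ℓ : Fin (d + 1) → ℝ) (μ : Fin d → SignType) : ℝ :=
  (∏ i : Fin d, B ν ℓ i (ext μ (i.val + 1)) (ext μ (i.val + 2))) /
    ∏ i : Fin d, b ν ℓ i (ext μ (i.val + 1))

section Cons

variable {d : ℕ} (ν : Fin (d + 1) → ℕ) (x : Fin (d + 1) → ℝ) (ℓ : Fin (d + 2) → ℝ) (N : ℝ)
  (p : SignType) (μ : Fin d → SignType)

theorem hahnP_succ :
    hahnP ν x ℓ N = hahnReg (ν 0) (x 0) (ℓ 0) (tailSum ℓ 2 - 2 * (tailSum ν 2 : ℕ))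
      (N - (tailSum ν 2 : ℕ)) * hahnP (Fin.tail ν) (Fin.tail x) (Fin.tail ℓ) (N - x 0) := by
  rw [hahnP, Fin.prod_univ_succ]
  congr 1
  · simp [headSum_zero]
  · refine Finset.prod_congr rfl fun i _ => ?_
    simp only [Fin.val_succ, tailSum_add_two, headSum_succ]
    rw [← sub_sub]
    rfl

theorem stepProd_cons :
    stepProd ν ℓ (Fin.cons p μ : Fin (d + 1) → SignType) =
      stepCoeff (ν 0) (ℓ 0) (tailSum ℓ 2 - 2 * (tailSum ν 2 : ℕ)) p (ext μ 1) /
        stepDen (2 * ν 0 - ℓ 0 - (tailSum ℓ 2 - 2 * (tailSum ν 2 : ℕ))) p *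
      stepProd (Fin.tail ν) (Fin.tail ℓ) μ := by
  simp only [stepProd, Fin.prod_univ_succ, Fin.val_zero, Fin.val_succ, zero_add, ext_cons_one,
    ext_cons_add_two, B_succ, b_succ, B_zero, b_zero]
  rw [mul_div_mul_comm]

theorem tailSum_two_toNat_shift_cons (h : ∀ i, 0 ≤ shift (Fin.tail ν) μ i) :
    ((tailSum (fun i => (shift ν (Fin.cons p μ : Fin (d + 1) → SignType) i).toNat) 2 : ℕ) : ℤ) =
      (tailSum ν 2 : ℕ) + (ext μ 1 : ℤ) := by
  rw [tailSum_two, tailSum_two]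
  push_cast
  rw [← sum_shift]
  refine Finset.sum_congr rfl fun i _ => ?_
  rw [Fin.tail, shift_cons_succ, Int.toNat_of_nonneg (h i)]

theorem atIndex_hahnP_cons {a : ℝ} (ha : tailSum ℓ 2 - 2 * (tailSum ν 2 : ℕ) = a) :
    atIndex (fun ν' => hahnP ν' x ℓ N) (shift ν (Fin.cons p μ : Fin (d + 1) → SignType)) =
      hahnZ (ν 0 + (p - ext μ 1)) (x 0) (ℓ 0) (ν 0 - ℓ 0 - a - 1 + (p + (ext μ 1 : ℝ)))
        (N - (tailSum ν 2 : ℕ) - (ext μ 1 : ℝ)) *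
      atIndex (fun ν' => hahnP ν' (Fin.tail x) (Fin.tail ℓ) (N - x 0)) (shift (Fin.tail ν) μ) := by
  subst ha
  unfold atIndex hahnZ
  simp only [Fin.forall_fin_succ, shift_cons_zero, shift_cons_succ]
  rw [ite_zero_mul_ite_zero]
  refine ite_congr rfl (fun h => ?_) fun _ => rfl
  have ht := congrArg (Int.cast : ℤ → ℝ) (tailSum_two_toNat_shift_cons ν p μ h.2)
  push_cast at ht
  rw [hahnP_succ, ht]
  simp only [shift_cons_zero]
  congr 1
  · congr 1 <;> push_cast <;> ring
  · congr 1
    funext i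
    simp only [Fin.tail, shift_cons_succ]

end Cons

theorem sum_cons {d : ℕ} (f : (Fin (d + 1) → SignType) → ℝ) :
    ∑ μ, f μ = ∑ μ : Fin d → SignType, ∑ p : SignType, f (Fin.cons p μ) := by
  rw [← (Fin.consEquiv fun _ : Fin (d + 1) => SignType).sum_comp, Fintype.sum_prod_type_right]
  rfl

theorem endCoeff_add (T L N t : ℝ) (p : SignType) :
    endCoeff (T + t) (L + 2 * t) (N + t) p = endCoeff T L N p := by
  cases p <;> simp only [endCoeff] <;> ring

/-- The parameters `ℓ` are such that no denominator in the one-variable relations vanishes. -/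
def GenericPar {d : ℕ} (ℓ : Fin (d + 1) → ℝ) : Prop :=
  (∀ (i : Fin d) (n : ℕ), ℓ i.castSucc ≠ n) ∧ ∀ (i : Fin d) (m : ℤ), tailSum ℓ (i.val + 1) ≠ m

theorem GenericPar.tail {d : ℕ} {ℓ : Fin (d + 2) → ℝ} (h : GenericPar ℓ) :
    GenericPar (Fin.tail ℓ) := by
  refine ⟨fun i n => h.1 i.succ n, fun i m => ?_⟩
  have := h.2 i.succ m
  rwa [Fin.val_succ, tailSum_add_two] at this

/-- One step of the induction on `d`: the sum over the first sign is a contiguous relation for the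
first factor, with `μ` the remaining signs. -/
theorem sum_endCoeff_mul_atIndex_hahnP_cons {d : ℕ} (ν : Fin (d + 1) → ℕ) (x : Fin (d + 1) → ℝ)
    {ℓ : Fin (d + 2) → ℝ} (N : ℝ) (hℓ : GenericPar ℓ) (μ : Fin d → SignType) :
    ∑ p : SignType, endCoeff (∑ i, ν i : ℕ) (∑ i, ℓ i) N p *
        stepProd ν ℓ (Fin.cons p μ : Fin (d + 1) → SignType) *
        atIndex (fun ν' => hahnP ν' x ℓ N) (shift ν (Fin.cons p μ : Fin (d + 1) → SignType)) =
      hahnReg (ν 0) (x 0) (ℓ 0) (tailSum ℓ 2 - 2 * (tailSum ν 2 : ℕ)) (N - (tailSum ν 2 : ℕ)) *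
        (endCoeff (∑ i, Fin.tail ν i : ℕ) (∑ i, Fin.tail ℓ i) (N - x 0) (ext μ 1) *
          stepProd (Fin.tail ν) (Fin.tail ℓ) μ *
          atIndex (fun ν' => hahnP ν' (Fin.tail x) (Fin.tail ℓ) (N - x 0))
            (shift (Fin.tail ν) μ)) := by
  have hsumℓ : ∑ i, ℓ i = ℓ 0 + tailSum ℓ 2 := sum_eq_zero_add_tailSum_two ℓ
  have hsumν : ∑ i, ν i = ν 0 + tailSum ν 2 := sum_eq_zero_add_tailSum_two ν
  have htail : ∀ m : ℤ, ℓ 0 + tailSum ℓ 2 ≠ m := by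
    simpa [tailSum_one, hsumℓ] using hℓ.2 0
  rw [← tailSum_two, ← tailSum_two, hsumℓ, hsumν]
  push_cast
  generalize ha : tailSum ℓ 2 - 2 * ((tailSum ν 2 : ℕ) : ℝ) = a
  generalize ht : ((tailSum ν 2 : ℕ) : ℝ) = t at ha ⊢
  have hℓt : tailSum ℓ 2 = a + 2 * t := by linarith
  have hla : ∀ m : ℤ, ℓ 0 + a ≠ m := fun m h =>
    htail (m + 2 * (tailSum ν 2 : ℕ)) (by push_cast; linarith)
  have endCoeff_eq (p : SignType) :
      endCoeff (ν 0 + t) (ℓ 0 + tailSum ℓ 2) N p = endCoeff (ν 0) (ℓ 0 + a) (N - t) p := by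
    rw [← endCoeff_add (ν 0) _ _ t, hℓt, sub_add_cancel, add_assoc]
  have endCoeff_tail_eq (q : SignType) :
      endCoeff t (tailSum ℓ 2) (N - x 0) q = endCoeff 0 a (N - t - x 0) q := by
    rw [← endCoeff_add 0 _ _ t, hℓt, zero_add, sub_right_comm, sub_add_cancel]
  rw [endCoeff_tail_eq, ← mul_assoc, ← mul_assoc, mul_comm (hahnReg _ _ _ _ _),
    ← hahnReg_contiguous (ν 0) (x 0) (l := ℓ 0) (N - t) (hℓ.1 0) hla (ext μ 1),
    Finset.sum_mul, Finset.sum_mul]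
  refine Finset.sum_congr rfl fun p _ => ?_
  rw [atIndex_hahnP_cons (a := a) ν x ℓ N p μ (by rw [ht, ha]), stepProd_cons, endCoeff_eq, ht, ha]
  ring

theorem hahnP_recurrence {d : ℕ} (ν : Fin d → ℕ) (x : Fin d → ℝ) {ℓ : Fin (d + 1) → ℝ} (N : ℝ)
    (hℓ : GenericPar ℓ) :
    ∑ μ : Fin d → SignType, endCoeff (∑ i, ν i : ℕ) (∑ i, ℓ i) N (ext μ 1) * stepProd ν ℓ μ *
        atIndex (fun ν' => hahnP ν' x ℓ N) (shift ν μ) =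
      (∑ i, x i - N + ℓ (Fin.last d) / 2) * hahnP ν x ℓ N := by
  induction d generalizing N with
  | zero => simp [ext, stepProd, atIndex, hahnP, endCoeff, ← SignType.zero_eq_zero]
  | succ d ih =>
    rw [sum_cons]
    simp only [ext_cons_one, sum_endCoeff_mul_atIndex_hahnP_cons ν x N hℓ]
    rw [← Finset.mul_sum, ih _ _ _ hℓ.tail, hahnP_succ, Fin.sum_univ_succ x]
    simp only [Fin.tail, Fin.succ_last]
    ring

/-! ### The full operator -/

theorem poch_neg_add (M : ℝ) (m n : ℕ) : poch (-M) (m + n) = poch (-M) m * poch (-(M - m)) n := by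
  rw [poch_add, neg_sub', sub_neg_eq_add]

theorem hahnReg_zero (n : ℕ) (l a M : ℝ) : hahnReg n 0 l a M = poch (-M) n := by
  rw [hahnReg, Finset.sum_eq_single 0]
  · simp [poch_zero]
  · intro k _ hk
    have : poch (-0) k = 0 := by
      simpa using (poch_neg_natCast_eq_zero_iff (n := 0)).2 (Nat.pos_of_ne_zero hk)
    rw [this]
    simp
  · simp

theorem hahnP_zero {d : ℕ} (ν : Fin d → ℕ) (ℓ : Fin (d + 1) → ℝ) (N : ℝ) :
    hahnP ν 0 ℓ N = poch (-N) (∑ i, ν i) := by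
  induction d with
  | zero => simp [hahnP, poch_zero]
  | succ d ih =>
    have tail_zero : Fin.tail (0 : Fin (d + 1) → ℝ) = 0 := rfl
    rw [hahnP_succ, tail_zero, Pi.zero_apply, hahnReg_zero, sub_zero, ih, ← tailSum_two,
      sum_eq_zero_add_tailSum_two ν, add_comm (ν 0), poch_neg_add, mul_comm]

theorem B_eq_zero {d : ℕ} {ν : Fin d → ℕ} {ℓ : Fin (d + 1) → ℝ} {i : Fin d} {p q : SignType}
    (h : (ν i : ℤ) + ((p : ℤ) - (q : ℤ)) < 0) : B ν ℓ i p q = 0 := by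
  have hν : ν i = 0 ∨ ν i = 1 := by
    cases p <;> cases q <;> simp at h <;> omega
  rcases hν with hν | hν <;> cases p <;> cases q <;> simp_all [B]

theorem stepProd_eq_zero {d : ℕ} {ν : Fin d → ℕ} {ℓ : Fin (d + 1) → ℝ} {μ : Fin d → SignType}
    (h : ¬∀ i, 0 ≤ shift ν μ i) : stepProd ν ℓ μ = 0 := by
  push Not at h
  obtain ⟨i, hi⟩ := h
  rw [stepProd, Finset.prod_eq_zero (Finset.mem_univ i) (B_eq_zero hi), zero_div]

theorem C_eq {d : ℕ} (ν : Fin d → ℕ) (ℓ : Fin (d + 1) → ℝ) (N : ℝ) (μ : Fin d → SignType) :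
    C ν ℓ N μ = B₀ ν ℓ N (ext μ 1) * stepProd ν ℓ μ := by
  rw [C, stepProd, mul_div_assoc]

theorem B₀_div_poch {d : ℕ} (ν : Fin d → ℕ) (ℓ : Fin (d + 1) → ℝ) {N : ℝ} {T : ℕ} {q : SignType}
    (hT : (T : ℤ) = ∑ i, (ν i : ℤ) + (q : ℤ)) (hNν : poch (-N) (∑ i, ν i) ≠ 0)
    (hNT : poch (-N) T ≠ 0) :
    B₀ ν ℓ N q * (1 / poch (-N) T) =
      1 / poch (-N) (∑ i, ν i) * endCoeff (∑ i, ν i : ℕ) (∑ i, ℓ i) N q := by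
  rw [← Nat.cast_sum] at hT
  simp only [B₀]
  generalize ∑ i, ν i = S at hT hNν ⊢
  cases q
  · obtain rfl : T = S := by simpa using hT
    simp only [endCoeff]
    ring
  · obtain rfl : S = T + 1 := by simp at hT; omega
    have hT0 : -N + T ≠ 0 := right_ne_zero_of_mul (poch_succ (-N) T ▸ hNν)
    rw [poch_succ]
    simp only [endCoeff]
    push_cast
    field_simp
    ring
  · obtain rfl : T = S + 1 := by simp at hT; omega
    have hS0 : -N + S ≠ 0 := right_ne_zero_of_mul (poch_succ (-N) S ▸ hNT)
    rw [poch_succ]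
    simp only [endCoeff]
    field_simp
    ring

theorem sum_toNat_shift {d : ℕ} {ν : Fin d → ℕ} {μ : Fin d → SignType}
    (h : ∀ i, 0 ≤ shift ν μ i) :
    ((∑ i, (shift ν μ i).toNat : ℕ) : ℤ) = ∑ i, (ν i : ℤ) + (ext μ 1 : ℤ) := by
  rw [← sum_shift]
  push_cast
  exact Finset.sum_congr rfl fun i _ => Int.toNat_of_nonneg (h i)

theorem shift_zero {d k : ℕ} (ν : Fin d → ℕ) :
    shift ν (0 : Fin k → SignType) = fun i => (ν i : ℤ) := by
  funext i
  simp [shift, ext]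

theorem self_mem_nbr {d : ℕ} (k : ℕ) (ν : Fin d → ℕ) : ν ∈ nbr k ν := ⟨0, shift_zero ν⟩

theorem mem_nbr_of_nonneg {d k : ℕ} {ν : Fin d → ℕ} {μ : Fin k → SignType}
    (h : ∀ i, 0 ≤ shift ν μ i) : (fun i => (shift ν μ i).toNat) ∈ nbr k ν :=
  ⟨μ, funext fun i => (Int.toNat_of_nonneg (h i)).symm⟩

theorem C_mul_atIndex_hahnQ {d : ℕ} {ν : Fin d → ℕ} {x : Fin d → ℝ} {ℓ : Fin (d + 1) → ℝ} {N : ℝ}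
    (hNν : poch (-N) (∑ i, ν i) ≠ 0)
    (hnbr : ∀ ν' ∈ nbr d ν, poch (-N) (∑ i, ν' i) ≠ 0 ∨ hahnP ν' x ℓ N = 0)
    (μ : Fin d → SignType) :
    C ν ℓ N μ * atIndex (fun ν' => hahnQ ν' x ℓ N) (shift ν μ) =
      1 / poch (-N) (∑ i, ν i) * (endCoeff (∑ i, ν i : ℕ) (∑ i, ℓ i) N (ext μ 1) *
        stepProd ν ℓ μ * atIndex (fun ν' => hahnP ν' x ℓ N) (shift ν μ)) := by
  unfold atIndex
  split_ifs with h
  · simp only [hahnQ_eq]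
    rcases hnbr _ (mem_nbr_of_nonneg h) with hNT | hP
    · rw [C_eq]
      linear_combination stepProd ν ℓ μ * hahnP (fun i => (shift ν μ i).toNat) x ℓ N *
        B₀_div_poch ν ℓ (sum_toNat_shift h) hNν hNT
    · simp only [hP, mul_zero]
  · simp only [mul_zero]

theorem sum_C_of_generic {d : ℕ} (ν : Fin d → ℕ) {ℓ : Fin (d + 1) → ℝ} {N : ℝ}
    (h : Generic ℓ N) : ∑ μ, C ν ℓ N μ = -N + ℓ (Fin.last d) / 2 := by
  have hN (S : ℕ) : poch (-N) S ≠ 0 := poch_neg_ne_zero h.1 S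
  have hahnQ_zero (ν' : Fin d → ℕ) : hahnQ ν' 0 ℓ N = 1 := by
    rw [hahnQ_eq, hahnP_zero, one_div_mul_cancel (hN _)]
  have C_mul_atIndex (μ : Fin d → SignType) :
      C ν ℓ N μ * atIndex (fun ν' => hahnQ ν' 0 ℓ N) (shift ν μ) = C ν ℓ N μ := by
    unfold atIndex
    split_ifs with hμ
    · simp only [hahnQ_zero, mul_one]
    · rw [C_eq, stepProd_eq_zero hμ, mul_zero, mul_zero]
  calc ∑ μ, C ν ℓ N μ = ∑ μ, C ν ℓ N μ * atIndex (fun ν' => hahnQ ν' 0 ℓ N) (shift ν μ) := by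
        simp only [C_mul_atIndex]
    _ = (∑ i, (0 : Fin d → ℝ) i - N + ℓ (Fin.last d) / 2) * hahnQ ν 0 ℓ N := by
        simp only [C_mul_atIndex_hahnQ (hN _) fun ν' _ => Or.inl (hN (∑ i, ν' i))]
        rw [← Finset.mul_sum, hahnP_recurrence ν 0 N h.2, hahnQ_eq]
        ring
    _ = -N + ℓ (Fin.last d) / 2 := by
        rw [hahnQ_zero]
        simp

/-! ### Passage to arbitrary parameters -/

section Density

open Filter MeasureTheory

theorem ae_ne_of_injective {f : ℝ → ℝ} (hf : Function.Injective f) (c : ℝ) : ∀ᵐ ε, f ε ≠ c :=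
  ae_iff.2 <| Set.Subsingleton.measure_zero (fun _ hε _ hε' =>
    hf ((not_not.1 hε).trans (not_not.1 hε').symm)) _

theorem ae_generic_add {d : ℕ} (ℓ : Fin (d + 1) → ℝ) (N : ℝ) :
    ∀ᵐ ε : ℝ, Generic (fun i => ℓ i + ε) (N + ε) := by
  simp only [Generic, eventually_and, ae_all_iff]
  refine ⟨fun n => ae_ne_of_injective (add_right_injective N) _,
    fun i n => ae_ne_of_injective (add_right_injective _) _,
    fun i m => ae_ne_of_injective (StrictMono.injective fun ε ε' h => ?_) _⟩
  exact Finset.sum_lt_sum_of_nonempty ⟨i.castSucc, by simp⟩ fun _ _ => add_lt_add_right h _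

theorem dense_generic {d : ℕ} : Dense {p : (Fin (d + 1) → ℝ) × ℝ | Generic p.1 p.2} := by
  rintro ⟨ℓ, N⟩
  have hcont : Continuous fun ε : ℝ => ((fun i => ℓ i + ε, N + ε) : (Fin (d + 1) → ℝ) × ℝ) := by
    fun_prop
  simpa only [add_zero] using map_mem_closure (t := {p : (Fin (d + 1) → ℝ) × ℝ | Generic p.1 p.2})
    hcont (Measure.dense_of_ae (ae_generic_add ℓ N) 0) fun _ hε => hε

theorem eq_of_forall_generic {d : ℕ} {ℓ : Fin (d + 1) → ℝ} {N : ℝ}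
    {F G : (Fin (d + 1) → ℝ) × ℝ → ℝ} (hF : ContinuousAt F (ℓ, N)) (hG : ContinuousAt G (ℓ, N))
    (h : ∀ p, Generic p.1 p.2 → F p = G p) : F (ℓ, N) = G (ℓ, N) := by
  let S : Set ((Fin (d + 1) → ℝ) × ℝ) := {p | Generic p.1 p.2}
  have : (nhdsWithin (ℓ, N) S).NeBot := mem_closure_iff_nhdsWithin_neBot.1 (dense_generic _)
  exact tendsto_nhds_unique_of_eventuallyEq (hF.mono_left (nhdsWithin_le_nhds (s := S)))
    (hG.mono_left nhdsWithin_le_nhds) (mem_of_superset self_mem_nhdsWithin h)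

end Density

theorem continuous_tailSum {n : ℕ} (j : ℕ) : Continuous fun y : Fin n → ℝ => tailSum y j := by
  unfold tailSum
  fun_prop

theorem continuousAt_stepProd {d : ℕ} {ν : Fin d → ℕ} {ℓ : Fin (d + 1) → ℝ}
    (hb : ∀ i p, b ν ℓ i p ≠ 0) (μ : Fin d → SignType) :
    ContinuousAt (fun ℓ' => stepProd ν ℓ' μ) ℓ := by
  have continuous_B (i : Fin d) (p q : SignType) :
      Continuous fun ℓ' : Fin (d + 1) → ℝ => B ν ℓ' i p q := by
    have h₁ := continuous_tailSum (n := d + 1) (i.val + 1)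
    have h₂ := continuous_tailSum (n := d + 1) (i.val + 2)
    cases p <;> cases q <;> simp only [B] <;> fun_prop
  have continuous_b (i : Fin d) (p : SignType) :
      Continuous fun ℓ' : Fin (d + 1) → ℝ => b ν ℓ' i p := by
    have h₁ := continuous_tailSum (n := d + 1) (i.val + 1)
    cases p <;> simp only [b] <;> fun_prop
  refine ContinuousAt.div ?_ ?_ (Finset.prod_ne_zero_iff.2 fun i _ => hb i _)
  · exact (continuous_finsetProd _ fun i _ => continuous_B i _ _).continuousAt
  · exact (continuous_finsetProd _ fun i _ => continuous_b i _).continuousAt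

theorem continuousAt_C {d : ℕ} {ν : Fin d → ℕ} {ℓ : Fin (d + 1) → ℝ}
    (hb : ∀ i p, b ν ℓ i p ≠ 0) (N : ℝ) (μ : Fin d → SignType) :
    ContinuousAt (fun p : (Fin (d + 1) → ℝ) × ℝ => C ν p.1 p.2 μ) (ℓ, N) := by
  have continuous_B₀ (q : SignType) :
      Continuous fun p : (Fin (d + 1) → ℝ) × ℝ => B₀ ν p.1 p.2 q := by
    cases q <;> simp only [B₀] <;> fun_prop
  simp only [C_eq]
  exact (continuous_B₀ _).continuousAt.mul
    (continuousAt_stepProd hb μ).fst'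

theorem continuousAt_hahnReg {n : ℕ} {x l : ℝ}
    (h : ∀ k ≤ n, poch (-l) k ≠ 0 ∨ poch (-x) k = 0) (a M : ℝ) :
    ContinuousAt (fun p : ℝ × ℝ × ℝ => hahnReg n x p.1 p.2.1 p.2.2) (l, a, M) := by
  unfold hahnReg
  refine tendsto_finsetSum _ fun k hk => ?_
  rcases h k (Finset.mem_range_succ_iff.1 hk) with hl | hx
  · refine ContinuousAt.mul (ContinuousAt.div ?_ ?_ (mul_ne_zero hl (by positivity))) ?_
    · exact ((continuous_const.mul ((continuous_poch k).comp (by fun_prop))).mul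
        continuous_const).continuousAt
    · exact (((continuous_poch k).comp (by fun_prop)).mul continuous_const).continuousAt
    · exact ((continuous_poch (n - k)).comp (by fun_prop)).continuousAt
  · simp only [hx, mul_zero, zero_div, zero_mul]
    exact tendsto_const_nhds

theorem continuousAt_hahnP {d : ℕ} {ν : Fin d → ℕ} {x : Fin d → ℝ} {ℓ : Fin (d + 1) → ℝ}
    (h : ∀ i, ∀ k ≤ ν i, poch (-ℓ i.castSucc) k ≠ 0 ∨ poch (-x i) k = 0) (N : ℝ) :
    ContinuousAt (fun p : (Fin (d + 1) → ℝ) × ℝ => hahnP ν x p.1 p.2) (ℓ, N) := by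
  have continuousAt_factor (i : Fin d) : ContinuousAt (fun p : (Fin (d + 1) → ℝ) × ℝ =>
      hahnReg (ν i) (x i) (p.1 i.castSucc)
        (tailSum p.1 (i.val + 2) - 2 * ((tailSum ν (i.val + 2) : ℕ) : ℝ))
        (p.2 - headSum x i.val - ((tailSum ν (i.val + 2) : ℕ) : ℝ))) (ℓ, N) := by
    refine ContinuousAt.comp (g := fun q : ℝ × ℝ × ℝ => hahnReg (ν i) (x i) q.1 q.2.1 q.2.2)
      (f := fun p : (Fin (d + 1) → ℝ) × ℝ => (p.1 i.castSucc, _, _))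
      (continuousAt_hahnReg (h i) _ _) (Continuous.continuousAt ?_)
    have := continuous_tailSum (n := d + 1) (i.val + 2)
    fun_prop
  unfold hahnP
  exact tendsto_finsetProd _ fun i _ => continuousAt_factor i

theorem continuousAt_atIndex {X : Type*} [TopologicalSpace X] {d : ℕ} {F : X → (Fin d → ℕ) → ℝ}
    {a : X} {n : Fin d → ℤ}
    (h : (∀ i, 0 ≤ n i) → ContinuousAt (fun t => F t fun i => (n i).toNat) a) :
    ContinuousAt (fun t => atIndex (F t) n) a := by
  unfold atIndex
  split_ifs with hn
  · exact h hn
  · exact continuousAt_const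

theorem sum_C {d : ℕ} {ν : Fin d → ℕ} {ℓ : Fin (d + 1) → ℝ} (hb : ∀ i p, b ν ℓ i p ≠ 0) (N : ℝ) :
    ∑ μ, C ν ℓ N μ = -N + ℓ (Fin.last d) / 2 := by
  refine eq_of_forall_generic (F := fun p => ∑ μ, C ν p.1 p.2 μ)
    (G := fun p => -p.2 + p.1 (Fin.last d) / 2) ?_ (by fun_prop) fun p hp => sum_C_of_generic ν hp
  exact tendsto_finsetSum _ fun μ _ => continuousAt_C hb N μ

theorem hahnP_recurrence_of_regular {d : ℕ} {ν : Fin d → ℕ} {x : Fin d → ℝ} {ℓ : Fin (d + 1) → ℝ}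
    (hb : ∀ i p, b ν ℓ i p ≠ 0)
    (hx : ∀ ν' ∈ nbr d ν, ∀ i, ∀ k ≤ ν' i, poch (-ℓ i.castSucc) k ≠ 0 ∨ poch (-x i) k = 0)
    (N : ℝ) :
    ∑ μ : Fin d → SignType, endCoeff (∑ i, ν i : ℕ) (∑ i, ℓ i) N (ext μ 1) * stepProd ν ℓ μ *
        atIndex (fun ν' => hahnP ν' x ℓ N) (shift ν μ) =
      (∑ i, x i - N + ℓ (Fin.last d) / 2) * hahnP ν x ℓ N := by
  refine eq_of_forall_generic (ℓ := ℓ) (N := N)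
    (F := fun p => ∑ μ, endCoeff _ (∑ i, p.1 i) p.2 (ext μ 1) * stepProd ν p.1 μ *
      atIndex (fun ν' => hahnP ν' x p.1 p.2) (shift ν μ))
    (G := fun p => (∑ i, x i - p.2 + p.1 (Fin.last d) / 2) * hahnP ν x p.1 p.2) ?_ ?_
    fun p hp => hahnP_recurrence ν x p.2 hp.2
  · refine tendsto_finsetSum _ fun μ _ => ContinuousAt.mul (ContinuousAt.mul ?_ ?_) ?_
    · exact ((continuous_endCoeff _ _).comp
        (f := fun p : (Fin (d + 1) → ℝ) × ℝ => (∑ i, p.1 i, p.2)) (by fun_prop)).continuousAt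
    · exact (continuousAt_stepProd hb μ).fst'
    · exact continuousAt_atIndex fun hμ => continuousAt_hahnP (hx _ (mem_nbr_of_nonneg hμ)) N
  · exact ContinuousAt.mul (by fun_prop) (continuousAt_hahnP (hx ν (self_mem_nbr d ν)) N)

theorem atIndex_natCast {d : ℕ} (f : (Fin d → ℕ) → ℝ) (ν : Fin d → ℕ) :
    atIndex f (fun i => (ν i : ℤ)) = f ν := by
  simp [atIndex]

theorem recOpFull_eq_sum {d : ℕ} (ℓ : Fin (d + 1) → ℝ) (N : ℝ) (f : (Fin d → ℕ) → ℝ)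
    (ν : Fin d → ℕ) :
    recOpFull ℓ N f ν = ∑ μ, C ν ℓ N μ * (atIndex f (shift ν μ) - f ν) := by
  rw [recOpFull, Finset.sum_filter]
  refine Finset.sum_congr rfl fun μ _ => ?_
  split_ifs with h
  · rfl
  · rw [not_not.1 h, shift_zero, atIndex_natCast, sub_self, mul_zero]

theorem recOpFull_hahnQ {d : ℕ} {ν : Fin d → ℕ} {x : Fin d → ℝ} {ℓ : Fin (d + 1) → ℝ} {N : ℝ}
    (hb : ∀ i p, b ν ℓ i p ≠ 0) (hNν : poch (-N) (∑ i, ν i) ≠ 0)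
    (hN : ∀ ν' ∈ nbr d ν, poch (-N) (∑ i, ν' i) ≠ 0 ∨ hahnP ν' x ℓ N = 0)
    (hx : ∀ ν' ∈ nbr d ν, ∀ i, ∀ k ≤ ν' i, poch (-ℓ i.castSucc) k ≠ 0 ∨ poch (-x i) k = 0) :
    recOpFull ℓ N (fun ν' => hahnQ ν' x ℓ N) ν = (∑ i, x i) * hahnQ ν x ℓ N := by
  rw [recOpFull_eq_sum]
  simp only [mul_sub, Finset.sum_sub_distrib, C_mul_atIndex_hahnQ hNν hN]
  rw [← Finset.mul_sum, ← Finset.sum_mul, hahnP_recurrence_of_regular hb hx, sum_C hb, hahnQ_eq]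
  ring

/-! ### Splitting off the last variables -/

section Split

variable {k m : ℕ} {M : Type} [AddCommMonoid M]

theorem tailSum_castAdd (y : Fin (k + m) → M) {j : ℕ} (hj : j ≤ k + 1) :
    tailSum y j = tailSum (fun i => y (Fin.castAdd m i)) j + ∑ i, y (Fin.natAdd k i) := by
  simp only [tailSum_eq_sum_ite, Fin.sum_univ_add, Fin.val_castAdd, Fin.val_natAdd]
  congr 1
  exact Finset.sum_congr rfl fun i _ => if_pos (by omega)

theorem tailSum_natAdd (y : Fin (k + m) → M) {j : ℕ} (hj : 1 ≤ j) :
    tailSum y (k + j) = tailSum (fun i => y (Fin.natAdd k i)) j := by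
  simp only [tailSum_eq_sum_ite, Fin.sum_univ_add, Fin.val_castAdd, Fin.val_natAdd, add_assoc,
    add_le_add_iff_left]
  rw [Finset.sum_eq_zero fun i _ => if_neg (by omega), zero_add]

theorem tailSum_succ_eq_sum_natAdd (y : Fin (k + m) → M) :
    tailSum y (k + 1) = ∑ i, y (Fin.natAdd k i) := by
  rw [tailSum_natAdd y le_rfl, tailSum_one]

theorem headSum_castAdd (y : Fin (k + m) → M) {j : ℕ} (hj : j ≤ k) :
    headSum y j = headSum (fun i => y (Fin.castAdd m i)) j := by
  simp only [headSum_eq_sum_ite, Fin.sum_univ_add, Fin.val_castAdd, Fin.val_natAdd]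
  rw [Finset.sum_eq_zero (s := (Finset.univ : Finset (Fin m))) fun i _ => if_neg (by omega),
    add_zero]

theorem headSum_self {n : ℕ} (y : Fin n → M) : headSum y n = ∑ i, y i := by
  rw [headSum, Finset.filter_true_of_mem fun i _ => i.isLt]

theorem headSum_natAdd (y : Fin (k + m) → M) (j : ℕ) :
    headSum y (k + j) =
      ∑ i, y (Fin.castAdd m i) + headSum (fun i => y (Fin.natAdd k i)) j := by
  simp only [headSum_eq_sum_ite, Fin.sum_univ_add, Fin.val_castAdd, Fin.val_natAdd, add_assoc,
    add_le_add_iff_left]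
  congr 1
  exact Finset.sum_congr rfl fun i _ => if_pos (by omega)

end Split

section Split

variable {k m : ℕ} (ν : Fin (k + m) → ℕ) (x : Fin (k + m) → ℝ) (ℓ : Fin (k + m + 1) → ℝ) (N : ℝ)

theorem headPar_castSucc (i : Fin k) :
    headPar (Nat.le_add_right k m) ν ℓ i.castSucc = ℓ (Fin.castAdd m i).castSucc :=
  Fin.snoc_castSucc ..

theorem tailSum_headPar {j : ℕ} (hj : j ≤ k + 1) :
    tailSum (headPar (Nat.le_add_right k m) ν ℓ) j =
      tailSum ℓ j - 2 * (∑ i, ν (Fin.natAdd k i) : ℕ) := by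
  have tailSum_ℓ : tailSum ℓ j =
      tailSum (fun i : Fin k => ℓ (Fin.castAdd m i).castSucc) j + tailSum ℓ (k + 1) :=
    (tailSum_castAdd (m := m + 1) ℓ hj).trans
      (congr_arg _ (tailSum_succ_eq_sum_natAdd (m := m + 1) ℓ).symm)
  rw [tailSum_ℓ, tailSum_eq_sum_ite, Fin.sum_univ_castSucc, ← tailSum_succ_eq_sum_natAdd]
  simp only [headPar_castSucc, Fin.val_castSucc, Fin.val_last, if_pos hj,
    tailSum_eq_sum_ite (n := k)]
  rw [headPar, Fin.snoc_last, add_sub_assoc]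

/-- The factors of `hahnQ` that are not affected by shifts of the first `k` indices. -/
def tailFactor : ℝ :=
  1 / poch (-N) (∑ i, ν (Fin.natAdd k i)) *
    hahnP (fun i => ν (Fin.natAdd k i)) (fun i => x (Fin.natAdd k i))
      (fun i : Fin (m + 1) => ℓ (Fin.natAdd k i)) (N - ∑ i, x (Fin.castAdd m i))

theorem hahnP_split :
    hahnP ν x ℓ N =
      hahnP (headIdx (Nat.le_add_right k m) ν) (fun i => x (Fin.castAdd m i))
          (headPar (Nat.le_add_right k m) ν ℓ) (N - (∑ i, ν (Fin.natAdd k i) : ℕ)) *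
        hahnP (fun i => ν (Fin.natAdd k i)) (fun i => x (Fin.natAdd k i))
          (fun i : Fin (m + 1) => ℓ (Fin.natAdd k i)) (N - ∑ i, x (Fin.castAdd m i)) := by
  rw [hahnP, Fin.prod_univ_add]
  refine congr_arg₂ _ (Finset.prod_congr rfl fun i _ => ?_) (Finset.prod_congr rfl fun i _ => ?_)
  · rw [Fin.val_castAdd, tailSum_castAdd ν (by omega), headSum_castAdd x (by omega),
      headPar_castSucc, tailSum_headPar ν ℓ (by omega)]
    simp only [headIdx]
    push_cast
    congr 1 <;> ring!
  · have tailSum_ℓ : tailSum ℓ (k + (i.val + 2)) = _ :=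
      tailSum_natAdd (m := m + 1) ℓ (Nat.le_add_left 1 _)
    simp only [Fin.val_natAdd, add_assoc, tailSum_ℓ, tailSum_natAdd ν (Nat.le_add_left 1 _),
      headSum_natAdd, sub_sub]
    rfl

theorem hahnQ_split :
    hahnQ ν x ℓ N = tailFactor ν x ℓ N *
      hahnQ (headIdx (Nat.le_add_right k m) ν) (fun i => x (Fin.castAdd m i))
        (headPar (Nat.le_add_right k m) ν ℓ) (N - (∑ i, ν (Fin.natAdd k i) : ℕ)) := by
  have poch_split : poch (-N) (∑ i, ν i) = poch (-N) (∑ i, ν (Fin.natAdd k i)) *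
      poch (-(N - (∑ i, ν (Fin.natAdd k i) : ℕ)))
        (∑ i, headIdx (Nat.le_add_right k m) ν i) := by
    rw [← poch_neg_add, Fin.sum_univ_add, add_comm]
    rfl
  rw [hahnQ_eq, hahnQ_eq, hahnP_split, poch_split, tailFactor]
  rw [← div_div]
  ring

end Split

theorem shift_castAdd {k m : ℕ} (ν : Fin (k + m) → ℕ) (μ : Fin k → SignType) (i : Fin k) :
    shift ν μ (Fin.castAdd m i) = shift (headIdx (Nat.le_add_right k m) ν) μ i := rfl

theorem shift_natAdd {k m : ℕ} (ν : Fin (k + m) → ℕ) (μ : Fin k → SignType) (i : Fin m) :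
    shift ν μ (Fin.natAdd k i) = ν (Fin.natAdd k i) := by
  rw [shift, ext, ext, dif_neg, dif_neg]
  · simp
  all_goals simp only [Fin.val_natAdd]; omega

theorem atIndex_hahnQ_split {k m : ℕ} (ν : Fin (k + m) → ℕ) (x : Fin (k + m) → ℝ)
    (ℓ : Fin (k + m + 1) → ℝ) (N : ℝ) (μ : Fin k → SignType) :
    atIndex (fun ν' => hahnQ ν' x ℓ N) (shift ν μ) = tailFactor ν x ℓ N *
      atIndex (fun ν' => hahnQ ν' (fun i => x (Fin.castAdd m i))
        (headPar (Nat.le_add_right k m) ν ℓ) (N - (∑ i, ν (Fin.natAdd k i) : ℕ)))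
        (shift (headIdx (Nat.le_add_right k m) ν) μ) := by
  have nonneg_iff : (∀ i, 0 ≤ shift ν μ i) ↔
      ∀ i, 0 ≤ shift (headIdx (Nat.le_add_right k m) ν) μ i := by
    simp [Fin.forall_fin_add, shift_castAdd, shift_natAdd]
  have toNat_natAdd (i : Fin m) : (shift ν μ (Fin.natAdd k i)).toNat = ν (Fin.natAdd k i) := by
    rw [shift_natAdd, Int.toNat_natCast]
  rw [atIndex, atIndex, mul_ite, mul_zero]
  refine ite_congr (propext nonneg_iff) (fun _ => ?_) fun _ => rfl
  rw [hahnQ_split, tailFactor]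
  simp only [toNat_natAdd, headPar, tailSum_succ_eq_sum_natAdd]
  rfl

theorem recOp_hahnQ_eq_tailFactor_mul {k m : ℕ} (ν : Fin (k + m) → ℕ) (x : Fin (k + m) → ℝ)
    (ℓ : Fin (k + m + 1) → ℝ) (N : ℝ) :
    recOp k (Nat.le_add_right k m) ℓ N (fun ν' => hahnQ ν' x ℓ N) ν = tailFactor ν x ℓ N *
      recOpFull (headPar (Nat.le_add_right k m) ν ℓ) (N - (∑ i, ν (Fin.natAdd k i) : ℕ))
        (fun ν' => hahnQ ν' (fun i => x (Fin.castAdd m i))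
          (headPar (Nat.le_add_right k m) ν ℓ) (N - (∑ i, ν (Fin.natAdd k i) : ℕ)))
        (headIdx (Nat.le_add_right k m) ν) := by
  rw [recOp, recOpFull, Finset.mul_sum]
  refine Finset.sum_congr rfl fun μ _ => ?_
  rw [atIndex_hahnQ_split, hahnQ_split ν, tailSum_succ_eq_sum_natAdd]
  ring

/-! ### The equations for regular indices -/

theorem poch_ne_zero_of_le {a : ℝ} {m n : ℕ} (hmn : m ≤ n) (h : poch a n ≠ 0) : poch a m ≠ 0 := by
  rw [← Nat.add_sub_cancel' hmn, poch_add] at h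
  exact left_ne_zero_of_mul h

theorem poch_neg_mul_comm (M : ℝ) (m n : ℕ) :
    poch (-M) m * poch (-(M - m)) n = poch (-M) n * poch (-(M - n)) m := by
  rw [← poch_neg_add, ← poch_neg_add, add_comm]

theorem poch_neg_ne_zero_or_eq_zero {l : ℝ} {x : ℕ} (h : poch (-l) x ≠ 0) (k : ℕ) :
    poch (-l) k ≠ 0 ∨ poch (-(x : ℝ)) k = 0 :=
  (le_or_gt k x).imp (poch_ne_zero_of_le · h) poch_neg_natCast_eq_zero_iff.2

theorem hahnReg_eq_zero {n x : ℕ} {M : ℝ} (hn : poch (-M) n = 0) (hx : poch (-M) x ≠ 0)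
    (l a : ℝ) : hahnReg n x l a M = 0 := by
  refine Finset.sum_eq_zero fun k hk => ?_
  rcases poch_neg_ne_zero_or_eq_zero hx k with hM | hxk
  · rw [← Nat.add_sub_cancel' (Finset.mem_range_succ_iff.1 hk), poch_add] at hn
    rw [(mul_eq_zero.1 hn).resolve_left hM, mul_zero]
  · rw [hxk, mul_zero, zero_div, zero_mul]

theorem hahnP_eq_zero {d : ℕ} {ν x : Fin d → ℕ} {N : ℝ} (hν : poch (-N) (∑ i, ν i) = 0)
    (hx : poch (-N) (∑ i, x i) ≠ 0) (ℓ : Fin (d + 1) → ℝ) :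
    hahnP ν (fun i => (x i : ℝ)) ℓ N = 0 := by
  induction d generalizing N with
  | zero => simp [poch_zero] at hν
  | succ d ih =>
    rw [sum_eq_zero_add_tailSum_two, tailSum_two, add_comm, poch_neg_add, mul_eq_zero] at hν
    rw [sum_eq_zero_add_tailSum_two, tailSum_two, poch_neg_add, mul_ne_zero_iff] at hx
    have tail_cast : Fin.tail (fun i => (x i : ℝ)) = fun i => (Fin.tail x i : ℝ) := rfl
    rw [hahnP_succ, tail_cast, tailSum_two ν]
    by_cases hν' : poch (-(N - x 0)) (∑ i, Fin.tail ν i) = 0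
    · rw [ih hν' hx.2, mul_zero]
    · have hne := mul_ne_zero hx.1 hν'
      rw [poch_neg_mul_comm, mul_ne_zero_iff] at hne
      rw [hahnReg_eq_zero (hν.resolve_left hne.1) hne.2, zero_mul]

/-- The factors `(-N)_{|y|}` and `(-ℓ_i)_{y_i}` do not vanish; for natural parameters this says
`|y| ≤ N` and `y_i ≤ ℓ_i`. For an index it means that the denominators in `Q̂_y` do not vanish; for
a point it is the part of the definition of `V` that matters for the equations. -/
def InRange {d : ℕ} (ℓ : Fin (d + 1) → ℝ) (N : ℝ) (y : Fin d → ℕ) : Prop :=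
  poch (-N) (∑ i, y i) ≠ 0 ∧ ∀ i, poch (-ℓ i.castSucc) (y i) ≠ 0

theorem b_head {d k : ℕ} (hk : k ≤ d) (ν : Fin d → ℕ) (ℓ : Fin (d + 1) → ℝ) (i : Fin k)
    (p : SignType) : b (headIdx hk ν) (headPar hk ν ℓ) i p = b ν ℓ (Fin.castLE hk i) p := by
  obtain ⟨m, rfl⟩ := Nat.exists_eq_add_of_le hk
  rw [b_eq_stepDen, b_eq_stepDen, Fin.val_castLE, tailSum_headPar ν ℓ (by omega),
    tailSum_castAdd ν (by omega)]
  congr 1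
  push_cast
  ring!

theorem Regular.b_head_ne_zero {d k : ℕ} (hk : k ≤ d) {ν : Fin d → ℕ} {ℓ : Fin (d + 1) → ℝ}
    (h : Regular k ℓ ν) (i : Fin k) (p : SignType) :
    b (headIdx hk ν) (headPar hk ν ℓ) i p ≠ 0 :=
  b_head hk ν ℓ i p ▸ h _ i.isLt p

section Split

variable {k m : ℕ} {ν : Fin (k + m) → ℕ} {ℓ : Fin (k + m + 1) → ℝ} {N : ℝ}

theorem append_mem_nbr {ν' : Fin k → ℕ} (h : ν' ∈ nbr k (headIdx (Nat.le_add_right k m) ν)) :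
    Fin.append ν' (fun i => ν (Fin.natAdd k i)) ∈ nbr k ν := by
  obtain ⟨μ, hμ⟩ := h
  refine ⟨μ, funext ((Fin.forall_fin_add _).2 ⟨fun i => ?_, fun i => ?_⟩)⟩
  · rw [shift_castAdd, hμ, Fin.append_left]
  · rw [shift_natAdd, Fin.append_right]

theorem recOp_hahnQ_of_recOpFull {x : Fin (k + m) → ℝ}
    (h : tailFactor ν x ℓ N = 0 ∨
      recOpFull (headPar (Nat.le_add_right k m) ν ℓ) (N - (∑ i, ν (Fin.natAdd k i) : ℕ))
        (fun ν' => hahnQ ν' (fun i => x (Fin.castAdd m i))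
          (headPar (Nat.le_add_right k m) ν ℓ) (N - (∑ i, ν (Fin.natAdd k i) : ℕ)))
        (headIdx (Nat.le_add_right k m) ν) =
      (∑ i, x (Fin.castAdd m i)) * hahnQ (headIdx (Nat.le_add_right k m) ν)
        (fun i => x (Fin.castAdd m i)) (headPar (Nat.le_add_right k m) ν ℓ)
        (N - (∑ i, ν (Fin.natAdd k i) : ℕ))) :
    recOp k (Nat.le_add_right k m) ℓ N (fun ν' => hahnQ ν' x ℓ N) ν =
      headSum x k * hahnQ ν x ℓ N := by
  rw [recOp_hahnQ_eq_tailFactor_mul, hahnQ_split ν]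
  rcases h with h | h
  · rw [h, zero_mul, zero_mul, mul_zero]
  · rw [h, headSum_castAdd x le_rfl, headSum_self, mul_left_comm]

end Split

theorem recOp_hahnQ {d k : ℕ} (hk : k ≤ d) {ν : Fin d → ℕ} {ℓ : Fin (d + 1) → ℝ} {N : ℝ}
    (hν : Regular k ℓ ν) (hN : ∀ ν' ∈ nbr k ν, InRange ℓ N ν') (x : Fin d → ℝ) :
    recOp k hk ℓ N (fun ν' => hahnQ ν' x ℓ N) ν = headSum x k * hahnQ ν x ℓ N := by
  obtain ⟨m, rfl⟩ := Nat.exists_eq_add_of_le hk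
  have poch_head_ne_zero {ν' : Fin k → ℕ} (hν' : ν' ∈ nbr k (headIdx hk ν)) :
      poch (-(N - (∑ i, ν (Fin.natAdd k i) : ℕ))) (∑ i, ν' i) ≠ 0 := by
    have := (hN _ (append_mem_nbr hν')).1
    simp only [Fin.sum_univ_add, Fin.append_left, Fin.append_right] at this
    rw [add_comm, poch_neg_add] at this
    exact right_ne_zero_of_mul this
  refine recOp_hahnQ_of_recOpFull <| .inr <| recOpFull_hahnQ (hν.b_head_ne_zero _)
    (poch_head_ne_zero (self_mem_nbr k _)) (fun ν' hν' => .inl (poch_head_ne_zero hν'))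
    fun ν' hν' i j hj => .inl (poch_ne_zero_of_le hj ?_)
  simpa [headPar_castSucc] using (hN _ (append_mem_nbr hν')).2 (Fin.castAdd m i)

theorem recOp_hahnQ_natCast {d k : ℕ} (hk : k ≤ d) {ν x : Fin d → ℕ} {ℓ : Fin (d + 1) → ℝ}
    {N : ℝ} (hν : Regular k ℓ ν) (hN : InRange ℓ N ν) (hx : InRange ℓ N x) :
    recOp k hk ℓ N (fun ν' => hahnQ ν' (fun i => (x i : ℝ)) ℓ N) ν =
      headSum (fun i => (x i : ℝ)) k * hahnQ ν (fun i => (x i : ℝ)) ℓ N := by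
  obtain ⟨m, rfl⟩ := Nat.exists_eq_add_of_le hk
  have hNν : poch (-N) (∑ i, ν i) ≠ 0 := hN.1
  have hNx : poch (-N) (∑ i, x i) ≠ 0 := hx.1
  rw [Fin.sum_univ_add, add_comm, poch_neg_add, mul_ne_zero_iff] at hNν
  rw [Fin.sum_univ_add, poch_neg_add, mul_ne_zero_iff] at hNx
  apply recOp_hahnQ_of_recOpFull
  by_cases htail : poch (-(N - (∑ i, x (Fin.castAdd m i) : ℕ))) (∑ i, ν (Fin.natAdd k i)) = 0
  · left
    rw [tailFactor, ← Nat.cast_sum, hahnP_eq_zero htail hNx.2, mul_zero]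
  · right
    have hMx := mul_ne_zero hNx.1 htail
    rw [poch_neg_mul_comm, mul_ne_zero_iff] at hMx
    refine recOpFull_hahnQ (hν.b_head_ne_zero _) hNν.2
      (fun ν' _ => or_iff_not_imp_left.2 fun h => hahnP_eq_zero (not_not.1 h) hMx.2 _)
      fun ν' _ i j _ => poch_neg_ne_zero_or_eq_zero ?_ j
    rw [headPar_castSucc]
    exact hx.2 _

/-! ### Linear independence -/

section LinearIndependence

open Polynomial

/-- The coefficient of `(-x)_k` in `hahnReg n x l a M`. -/
def hahnCoeff (n : ℕ) (l a M : ℝ) (k : ℕ) : ℝ :=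
  poch (-(n : ℝ)) k * poch (n - l - a - 1) k / (poch (-l) k * (k.factorial : ℝ)) *
    poch (-M + k) (n - k)

/-- `hahnReg` as a polynomial in `x`. -/
def hahnPoly (n : ℕ) (l a M : ℝ) : ℝ[X] :=
  ∑ k ∈ Finset.range (n + 1), hahnCoeff n l a M k • (ascPochhammer ℝ k).comp (-X)

theorem eval_hahnPoly (n : ℕ) (x l a M : ℝ) : (hahnPoly n l a M).eval x = hahnReg n x l a M := by
  simp only [hahnPoly, eval_finsetSum, eval_smul, eval_comp, eval_neg, eval_X]
  refine Finset.sum_congr rfl fun k _ => ?_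
  rw [hahnCoeff, smul_eq_mul, ← poch]
  ring

theorem degree_ascPochhammer_comp_neg_X (k : ℕ) :
    ((ascPochhammer ℝ k).comp (-X)).degree = k := by
  have natDegree_eq : ((ascPochhammer ℝ k).comp (-X)).natDegree = k := by
    rw [natDegree_comp, ascPochhammer_natDegree, natDegree_neg, natDegree_X, mul_one]
  rcases k.eq_zero_or_pos with rfl | hk
  · simp
  · exact (degree_eq_iff_natDegree_eq_of_pos hk).2 natDegree_eq

theorem degree_hahnPoly (n : ℕ) {l a : ℝ} (M : ℝ) (hl : ∀ m : ℕ, l ≠ m)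
    (hla : ∀ m : ℤ, l + a ≠ m) : (hahnPoly n l a M).degree = n := by
  have hahnCoeff_self_ne_zero : hahnCoeff n l a M n ≠ 0 := by
    rw [hahnCoeff, Nat.sub_self, poch_zero, mul_one, show n - l - a - 1 = -(l + a + 1 - n) by ring]
    refine div_ne_zero (mul_ne_zero ?_ ?_) (mul_ne_zero (poch_neg_ne_zero hl n) (by positivity))
    · exact poch_neg_natCast_eq_zero_iff.not.2 (lt_irrefl n)
    · refine poch_neg_ne_zero (fun m h => hla (m + n - 1) ?_) n
      push_cast
      linarith
  have degree_top : (hahnCoeff n l a M n • (ascPochhammer ℝ n).comp (-X)).degree = n := by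
    rw [smul_eq_C_mul, degree_C_mul hahnCoeff_self_ne_zero, degree_ascPochhammer_comp_neg_X]
  have degree_lower : (∑ k ∈ Finset.range n,
      hahnCoeff n l a M k • (ascPochhammer ℝ k).comp (-X)).degree < n := by
    refine (degree_sum_le _ _).trans_lt ?_
    refine (Finset.sup_lt_iff (WithBot.bot_lt_coe n)).2 fun k hk => ?_
    refine (degree_smul_le _ _).trans_lt ?_
    rw [degree_ascPochhammer_comp_neg_X]
    exact Nat.cast_lt.2 (Finset.mem_range.1 hk)
  rw [hahnPoly, Finset.sum_range_succ, degree_add_eq_right_of_degree_lt] <;> rw [degree_top]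
  exact degree_lower

theorem linearIndependent_hahnReg {l a : ℝ} (M : ℝ) (hl : ∀ m : ℕ, l ≠ m)
    (hla : ∀ m : ℤ, l + a ≠ m) :
    LinearIndependent ℝ fun (n : ℕ) (x : ℝ) => hahnReg n x l a M := by
  let S : Polynomial.Sequence ℝ :=
    { elems' := fun n => hahnPoly n l a M
      degree_eq' := fun n => degree_hahnPoly n M hl hla }
  let evalMap : ℝ[X] →ₗ[ℝ] ℝ → ℝ := LinearMap.pi leval
  have ker_evalMap : LinearMap.ker evalMap = ⊥ :=
    LinearMap.ker_eq_bot.2 fun p q h => Polynomial.funext (congrFun h)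
  have comp_eq : evalMap ∘ S = fun n x => hahnReg n x l a M :=
    funext₂ fun n x => eval_hahnPoly n x l a M
  exact comp_eq ▸ S.linearIndependent.map' evalMap ker_evalMap

theorem linearIndependent_mul {K ι κ X Y : Type*} [CommRing K] {u : κ → ι → X → K}
    {v : X → κ → Y → K} (hu : ∀ j, LinearIndependent K (u j))
    (hv : ∀ x, LinearIndependent K (v x)) :
    LinearIndependent K fun (p : κ × ι) (q : X × Y) => u p.1 p.2 q.1 * v q.1 p.1 q.2 := by
  classical
  refine linearIndependent_iff''.2 fun s c hc h ⟨j, i⟩ => ?_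
  have sum_eq (q : X × Y) : ∑ j ∈ s.image Prod.fst, (∑ i ∈ s.image Prod.snd,
      c (j, i) * u j i q.1) * v q.1 j q.2 = 0 := by
    simp only [Finset.sum_mul]
    rw [← Finset.sum_product', ← Finset.sum_subset Finset.subset_product fun p _ hp => by
      rw [hc p hp, zero_mul, zero_mul]]
    simpa [mul_assoc] using congrFun h q
  by_cases hj : (j, i) ∈ s
  · refine linearIndependent_iff'.1 (hu j) (s.image Prod.snd) (fun i => c (j, i))
      (funext fun x => ?_) i (Finset.mem_image_of_mem Prod.snd hj)
    simpa using linearIndependent_iff'.1 (hv x) (s.image Prod.fst)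
      (fun j => ∑ i ∈ s.image Prod.snd, c (j, i) * u j i x)
      (funext fun y => by simpa using sum_eq (x, y)) j (Finset.mem_image_of_mem Prod.fst hj)
  · exact hc _ hj

theorem GenericPar.linearIndependent_hahnP {d : ℕ} {ℓ : Fin (d + 1) → ℝ} (hℓ : GenericPar ℓ)
    (N : ℝ) : LinearIndependent ℝ fun (ν : Fin d → ℕ) (x : Fin d → ℝ) => hahnP ν x ℓ N := by
  induction d generalizing N with
  | zero => exact LinearIndependent.of_subsingleton 0 fun h => by simpa [hahnP] using congrFun h 0
  | succ d ih =>
    have hla (n : ℕ) (m : ℤ) : ℓ 0 + (tailSum ℓ 2 - 2 * (n : ℝ)) ≠ m := by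
      intro hm
      refine hℓ.2 0 (m + 2 * n) ?_
      rw [Fin.val_zero, zero_add, tailSum_one, sum_eq_zero_add_tailSum_two]
      push_cast
      linarith
    let u (ν : Fin d → ℕ) (n : ℕ) (x₀ : ℝ) : ℝ :=
      hahnReg n x₀ (ℓ 0) (tailSum ℓ 2 - 2 * (∑ i, ν i : ℕ)) (N - (∑ i, ν i : ℕ))
    let v (x₀ : ℝ) (ν : Fin d → ℕ) (x : Fin d → ℝ) : ℝ := hahnP ν x (Fin.tail ℓ) (N - x₀)
    have linearIndependent_u_mul_v : LinearIndependent ℝ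
        fun (p : (Fin d → ℕ) × ℕ) (q : ℝ × (Fin d → ℝ)) => u p.1 p.2 q.1 * v q.1 p.1 q.2 :=
      linearIndependent_mul (fun ν => linearIndependent_hahnReg _ (hℓ.1 0) (hla (∑ i, ν i)))
        fun x₀ => ih hℓ.tail (N - x₀)
    let split (ν : Fin (d + 1) → ℕ) : (Fin d → ℕ) × ℕ := (Fin.tail ν, ν 0)
    have injective_split : Function.Injective split := fun ν ν' h => by
      rw [← Fin.cons_self_tail ν, ← Fin.cons_self_tail ν', (Prod.mk.inj h).1, (Prod.mk.inj h).2]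
    let restrict : ((Fin (d + 1) → ℝ) → ℝ) →ₗ[ℝ] ℝ × (Fin d → ℝ) → ℝ :=
      LinearMap.funLeft ℝ ℝ fun q => Fin.cons q.1 q.2
    have restrict_hahnP : (restrict ∘ fun ν x => hahnP ν x ℓ N) =
        (fun p q => u p.1 p.2 q.1 * v q.1 p.1 q.2) ∘ split := by
      funext ν q
      simp only [restrict, u, v, split, Function.comp_apply, LinearMap.funLeft_apply,
        hahnP_succ, tailSum_two ν, Fin.cons_zero, Fin.tail_cons]
    refine LinearIndependent.of_comp restrict ?_
    rw [restrict_hahnP]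
    exact linearIndependent_u_mul_v.comp _ injective_split

theorem Generic.linearIndependent_hahnQ {d : ℕ} {ℓ : Fin (d + 1) → ℝ} {N : ℝ}
    (h : Generic ℓ N) :
    LinearIndependent ℝ fun (ν : Fin d → ℕ) (x : Fin d → ℝ) => hahnQ ν x ℓ N :=
  (GenericPar.linearIndependent_hahnP h.2 N).units_smul fun ν =>
    Units.mk0 _ (one_div_ne_zero (poch_neg_ne_zero h.1 (∑ i, ν i)))

end LinearIndependence

/-! ### Commutation -/

theorem Generic.inRange {d : ℕ} {ℓ : Fin (d + 1) → ℝ} {N : ℝ} (h : Generic ℓ N) (y : Fin d → ℕ) :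
    InRange ℓ N y :=
  ⟨poch_neg_ne_zero h.1 _, fun i => poch_neg_ne_zero (h.2.1 i) _⟩

theorem stepDen_ne_zero {s : ℝ} (h0 : s ≠ 0) (h1 : s ≠ 1) (h2 : s ≠ 2) (p : SignType) :
    stepDen s p ≠ 0 := by
  cases p
  · exact div_ne_zero (mul_ne_zero h0 (sub_ne_zero.2 h2)) two_ne_zero
  · exact mul_ne_zero (sub_ne_zero.2 h2) (sub_ne_zero.2 h1)
  · exact mul_ne_zero h0 (sub_ne_zero.2 h1)

theorem Generic.regular {d : ℕ} {ℓ : Fin (d + 1) → ℝ} {N : ℝ} (h : Generic ℓ N) (k : ℕ)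
    (ν : Fin d → ℕ) : Regular k ℓ ν := by
  intro i _ p
  have ne_intCast (m : ℤ) : 2 * (tailSum ν (i.val + 1) : ℕ) - tailSum ℓ (i.val + 1) ≠ m := by
    intro hm
    refine h.2.2 i (2 * (tailSum ν (i.val + 1) : ℕ) - m) ?_
    push_cast
    linarith
  rw [b_eq_stepDen]
  exact stepDen_ne_zero (mod_cast ne_intCast 0) (mod_cast ne_intCast 1) (mod_cast ne_intCast 2) p

theorem exists_atIndex_eq_linearCombination {d : ℕ} (n : Fin d → ℤ) :
    ∃ e : (Fin d → ℕ) →₀ ℝ, ∀ f, atIndex f n = Finsupp.linearCombination ℝ f e := by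
  by_cases h : ∀ i, 0 ≤ n i
  · exact ⟨Finsupp.single (fun i => (n i).toNat) 1, fun f => by simp [atIndex, h]⟩
  · exact ⟨0, fun f => by rw [atIndex, if_neg h, map_zero]⟩

theorem exists_recOp_eq_linearCombination {d k : ℕ} (hk : k ≤ d) (ℓ : Fin (d + 1) → ℝ) (N : ℝ) :
    ∃ T : (Fin d → ℕ) → (Fin d → ℕ) →₀ ℝ,
      ∀ f, recOp k hk ℓ N f = fun ν => Finsupp.linearCombination ℝ f (T ν) := by
  choose e he using exists_atIndex_eq_linearCombination (d := d)
  refine ⟨fun ν => ∑ μ : Fin k → SignType with μ ≠ 0,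
    C (headIdx hk ν) (headPar hk ν ℓ) (N - (tailSum ν (k + 1) : ℕ)) μ •
      (e (shift ν μ) - Finsupp.single ν 1), fun f => funext fun ν => ?_⟩
  simp [recOp, he]

theorem recOp_smul {d k : ℕ} (hk : k ≤ d) (ℓ : Fin (d + 1) → ℝ) (N a : ℝ) (f : (Fin d → ℕ) → ℝ) :
    recOp k hk ℓ N (a • f) = a • recOp k hk ℓ N f := by
  obtain ⟨T, hT⟩ := exists_recOp_eq_linearCombination hk ℓ N
  funext ν
  simp only [hT, Pi.smul_apply]
  exact congrArg (· (T ν)) (map_smul (Finsupp.bilinearCombination ℝ ℝ) a f)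

theorem Generic.recOp_comm {d j k : ℕ} (hj : j ≤ d) (hk : k ≤ d) {ℓ : Fin (d + 1) → ℝ} {N : ℝ}
    (h : Generic ℓ N) (f : (Fin d → ℕ) → ℝ) :
    recOp j hj ℓ N (recOp k hk ℓ N f) = recOp k hk ℓ N (recOp j hj ℓ N f) := by
  have recOp_Q {i : ℕ} (hi : i ≤ d) (x : Fin d → ℝ) :
      recOp i hi ℓ N (fun ν => hahnQ ν x ℓ N) = headSum x i • fun ν => hahnQ ν x ℓ N :=
    funext fun ν => recOp_hahnQ hi (h.regular i ν) (fun ν' _ => h.inRange ν') x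
  obtain ⟨S, hS⟩ := exists_recOp_eq_linearCombination hj ℓ N
  obtain ⟨T, hT⟩ := exists_recOp_eq_linearCombination hk ℓ N
  have comp_hahnQ (x : Fin d → ℝ) : recOp j hj ℓ N (recOp k hk ℓ N fun ν => hahnQ ν x ℓ N) =
      recOp k hk ℓ N (recOp j hj ℓ N fun ν => hahnQ ν x ℓ N) := by
    rw [recOp_Q, recOp_Q, recOp_smul, recOp_smul, recOp_Q, recOp_Q, smul_comm]
  simp only [hS, hT, ← Finsupp.linearCombination_linearCombination] at comp_hahnQ ⊢
  have comp_eq (ν : Fin d → ℕ) :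
      Finsupp.linearCombination ℝ T (S ν) = Finsupp.linearCombination ℝ S (T ν) := by
    refine h.linearIndependent_hahnQ (funext fun x => ?_)
    have eval_eq (c : (Fin d → ℕ) →₀ ℝ) :
        Finsupp.linearCombination ℝ (fun ν x => hahnQ ν x ℓ N) c x =
          Finsupp.linearCombination ℝ (fun ν => hahnQ ν x ℓ N) c :=
      Finsupp.apply_linearCombination ℝ (LinearMap.proj (φ := fun _ => ℝ) x) _ c
    rw [eval_eq, eval_eq]
    exact congrFun (comp_hahnQ x) ν
  simp only [comp_eq]

theorem continuousAt_recOp {d k : ℕ} (hk : k ≤ d) {ν : Fin d → ℕ} {ℓ : Fin (d + 1) → ℝ} {N : ℝ}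
    (hν : Regular k ℓ ν) {F : (Fin (d + 1) → ℝ) × ℝ → (Fin d → ℕ) → ℝ}
    (hF : ∀ ν' ∈ nbr k ν, ContinuousAt (fun p => F p ν') (ℓ, N)) :
    ContinuousAt (fun p => recOp k hk p.1 p.2 (F p) ν) (ℓ, N) := by
  have continuous_headPar : Continuous (headPar hk ν) := by
    have := continuous_tailSum (n := d + 1) (k + 1)
    exact Continuous.finSnoc (by fun_prop) (by fun_prop)
  refine tendsto_finsetSum _ fun μ _ => ContinuousAt.mul ?_ (ContinuousAt.sub ?_ ?_)
  · exact ContinuousAt.comp (g := fun p => C (headIdx hk ν) p.1 p.2 μ)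
      (f := fun p : (Fin (d + 1) → ℝ) × ℝ => (headPar hk ν p.1, p.2 - (tailSum ν (k + 1) : ℕ)))
      (continuousAt_C (hν.b_head_ne_zero hk) _ μ) (Continuous.continuousAt (by fun_prop))
  · exact continuousAt_atIndex fun hμ => hF _ (mem_nbr_of_nonneg hμ)
  · exact hF ν (self_mem_nbr k ν)

theorem recOp_comm_of_regular {d j k : ℕ} (hj : j ≤ d) (hk : k ≤ d) {ν : Fin d → ℕ}
    {ℓ : Fin (d + 1) → ℝ} (hjν : Regular j ℓ ν) (hkν : Regular k ℓ ν)
    (hjk : ∀ ν' ∈ nbr j ν, Regular k ℓ ν') (hkj : ∀ ν' ∈ nbr k ν, Regular j ℓ ν') (N : ℝ)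
    (f : (Fin d → ℕ) → ℝ) :
    recOp j hj ℓ N (recOp k hk ℓ N f) ν = recOp k hk ℓ N (recOp j hj ℓ N f) ν := by
  have continuousAt_recOp_const {i : ℕ} (hi : i ≤ d) {ν' : Fin d → ℕ} (hν' : Regular i ℓ ν') :
      ContinuousAt (fun p : (Fin (d + 1) → ℝ) × ℝ => recOp i hi p.1 p.2 f ν') (ℓ, N) :=
    continuousAt_recOp hi hν' fun _ _ => continuousAt_const
  exact eq_of_forall_generic
    (F := fun p => recOp j hj p.1 p.2 (recOp k hk p.1 p.2 f) ν)
    (G := fun p => recOp k hk p.1 p.2 (recOp j hj p.1 p.2 f) ν)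
    (continuousAt_recOp hj hjν fun ν' h => continuousAt_recOp_const hk (hjk ν' h))
    (continuousAt_recOp hk hkν fun ν' h => continuousAt_recOp_const hj (hkj ν' h))
    fun p hp => congrFun (hp.recOp_comm hj hk f) ν

/-! ### Natural parameters -/

theorem tailSum_succ {M : Type} [AddCommMonoid M] {n : ℕ} (y : Fin n → M) (i : Fin n) :
    tailSum y (i.val + 1) = y i + tailSum y (i.val + 2) := by
  have filter_eq : (Finset.univ.filter fun k : Fin n => i.val + 1 ≤ k.val + 1) =
      insert i (Finset.univ.filter fun k : Fin n => i.val + 2 ≤ k.val + 1) := by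
    grind
  rw [tailSum, filter_eq, Finset.sum_insert (by simp), tailSum]

theorem tailSum_natCast {n : ℕ} (y : Fin n → ℕ) (j : ℕ) :
    tailSum (fun i => (y i : ℝ)) j = (tailSum y j : ℕ) :=
  (Nat.cast_sum _ _).symm

theorem update_succ_mem_nbr {d k : ℕ} (ν : Fin d → ℕ) {i : Fin d} (hi : i.val < k) :
    Function.update ν i (ν i + 1) ∈ nbr k ν := by
  let μ (j : Fin k) : SignType := if j.val ≤ i.val then 1 else 0
  have ext_μ (n : ℕ) : ext μ (n + 1) = if n ≤ i.val then 1 else 0 := by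
    unfold ext
    grind
  refine ⟨μ, funext fun j => ?_⟩
  rw [shift, ext_μ j, ext_μ (j + 1), Function.update_apply]
  grind [SignType.coe_zero, SignType.coe_one]

theorem regular_of_nbr_subset {d k : ℕ} {ℓ : Fin (d + 1) → ℕ} {N : ℕ} {ν : Fin d → ℕ}
    (h : nbr k ν ⊆ H ℓ N) : Regular k (fun i => (ℓ i : ℝ)) ν := by
  intro i hi p
  have tailSum_update :
      tailSum (Function.update ν i (ν i + 1)) (i.val + 2) = tailSum ν (i.val + 2) :=
    Finset.sum_congr rfl fun j hj => Function.update_of_ne (by grind) _ _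
  have bounds := (h (update_succ_mem_nbr ν hi)).2.2 i
  rw [tailSum_update, Function.update_self] at bounds
  have tailSum_lt : 2 * tailSum ν (i.val + 1) < tailSum ℓ (i.val + 1) := by
    have := tailSum_succ ℓ i.castSucc
    have := tailSum_succ ν i
    grind
  have neg : (2 * tailSum ν (i.val + 1) - tailSum ℓ (i.val + 1) : ℝ) < 0 := by
    exact_mod_cast sub_neg.2 (Nat.cast_lt (α := ℝ).2 tailSum_lt)
  rw [b_eq_stepDen, tailSum_natCast]
  exact stepDen_ne_zero neg.ne (by linarith) (by linarith) p

theorem inRange_natCast {d : ℕ} {ℓ : Fin (d + 1) → ℕ} {N : ℕ} {y : Fin d → ℕ}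
    (hN : ∑ i, y i ≤ N) (hℓ : ∀ i, y i ≤ ℓ i.castSucc) : InRange (fun i => (ℓ i : ℝ)) N y :=
  ⟨poch_neg_natCast_eq_zero_iff.not.2 hN.not_gt,
    fun i => poch_neg_natCast_eq_zero_iff.not.2 (hℓ i).not_gt⟩

theorem inRange_of_mem_H {d : ℕ} {ℓ : Fin (d + 1) → ℕ} {N : ℕ} {ν : Fin d → ℕ}
    (hν : ν ∈ H ℓ N) : InRange (fun i => (ℓ i : ℝ)) N ν :=
  inRange_natCast hν.1 fun i => (hν.2.2 i).1

theorem inRange_of_mem_V {d : ℕ} {ℓ : Fin (d + 1) → ℕ} {N : ℕ} {x : Fin d → ℕ}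
    (hx : x ∈ V ℓ N) : InRange (fun i => (ℓ i : ℝ)) N x :=
  inRange_natCast hx.2.2 hx.1

end

end HahnRec

theorem theorem6p2_general {d : ℕ} (ℓ : Fin (d + 1) → ℝ) (N : ℝ) :
    (∀ (k : ℕ) (hk : k ≤ d) (ν : Fin d → ℕ) (x : Fin d → ℝ),
      HahnRec.Regular k ℓ ν → (∀ ν' ∈ HahnRec.nbr k ν, HahnRec.InRange ℓ N ν') →
      HahnRec.recOp k hk ℓ N (fun ν' => HahnRec.hahnQ ν' x ℓ N) ν =
        HahnRec.headSum x k * HahnRec.hahnQ ν x ℓ N) ∧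
    (∀ (k : ℕ) (hk : k ≤ d) (ν x : Fin d → ℕ),
      HahnRec.Regular k ℓ ν → HahnRec.InRange ℓ N ν → HahnRec.InRange ℓ N x →
      HahnRec.recOp k hk ℓ N (fun ν' => HahnRec.hahnQ ν' (fun i => (x i : ℝ)) ℓ N) ν =
        HahnRec.headSum (fun i => (x i : ℝ)) k *
          HahnRec.hahnQ ν (fun i => (x i : ℝ)) ℓ N) ∧
    (∀ (j k : ℕ) (hj : j ≤ d) (hk : k ≤ d) (f : (Fin d → ℕ) → ℝ) (ν : Fin d → ℕ),
      HahnRec.Regular j ℓ ν → HahnRec.Regular k ℓ ν →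
      (∀ ν' ∈ HahnRec.nbr j ν, HahnRec.Regular k ℓ ν') →
      (∀ ν' ∈ HahnRec.nbr k ν, HahnRec.Regular j ℓ ν') →
      HahnRec.recOp j hj ℓ N (HahnRec.recOp k hk ℓ N f) ν =
        HahnRec.recOp k hk ℓ N (HahnRec.recOp j hj ℓ N f) ν) :=
  ⟨fun _ hk _ x hν hN => HahnRec.recOp_hahnQ hk hν hN x,
    fun _ hk _ _ hν hN hx => HahnRec.recOp_hahnQ_natCast hk hν hN hx,
    fun _ _ hj hk f _ hjν hkν hjk hkj => HahnRec.recOp_comm_of_regular hj hk hjν hkν hjk hkj N f⟩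

theorem theorem6p2 (d : ℕ) :
    -- generic real parameters: all indices, all points
    (∀ (ℓ : Fin (d + 1) → ℝ) (N : ℝ), HahnRec.Generic ℓ N →
      (∀ (k : ℕ) (hk : k ≤ d), 1 ≤ k → ∀ (ν : Fin d → ℕ) (x : Fin d → ℝ),
        HahnRec.recOp k hk ℓ N (fun ν' => HahnRec.hahnQ ν' x ℓ N) ν =
          HahnRec.headSum x k * HahnRec.hahnQ ν x ℓ N) ∧
      (∀ (j k : ℕ) (hj : j ≤ d) (hk : k ≤ d) (f : (Fin d → ℕ) → ℝ),
        HahnRec.recOp j hj ℓ N (HahnRec.recOp k hk ℓ N f) =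
          HahnRec.recOp k hk ℓ N (HahnRec.recOp j hj ℓ N f))) ∧
    -- nonnegative integer parameters
    (∀ (ℓ : Fin (d + 1) → ℕ) (N : ℕ), HahnRec.Admissible ℓ N →
      -- all points, if the indices on the left-hand side belong to `H`
      (∀ (k : ℕ) (hk : k ≤ d), 1 ≤ k → ∀ (ν : Fin d → ℕ) (x : Fin d → ℝ),
        HahnRec.nbr k ν ⊆ HahnRec.H ℓ N →
        HahnRec.recOp k hk (fun i => (ℓ i : ℝ)) N
            (fun ν' => HahnRec.hahnQ ν' x (fun i => (ℓ i : ℝ)) N) ν =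
          HahnRec.headSum x k * HahnRec.hahnQ ν x (fun i => (ℓ i : ℝ)) N) ∧
      -- points of the polyhedron, for every index in `H` at which the coefficients are finite
      (∀ (k : ℕ) (hk : k ≤ d), 1 ≤ k → ∀ ν ∈ HahnRec.H ℓ N, ∀ x ∈ HahnRec.V ℓ N,
        HahnRec.Regular k (fun i => (ℓ i : ℝ)) ν →
        HahnRec.recOp k hk (fun i => (ℓ i : ℝ)) N
            (fun ν' => HahnRec.hahnQ ν' (fun i => (x i : ℝ)) (fun i => (ℓ i : ℝ)) N) ν =
          HahnRec.headSum (fun i => (x i : ℝ)) k *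
            HahnRec.hahnQ ν (fun i => (x i : ℝ)) (fun i => (ℓ i : ℝ)) N) ∧
      -- the operators commute wherever the coefficients involved are finite
      (∀ (j k : ℕ) (hj : j ≤ d) (hk : k ≤ d) (f : (Fin d → ℕ) → ℝ) (ν : Fin d → ℕ),
        HahnRec.Regular j (fun i => (ℓ i : ℝ)) ν →
        HahnRec.Regular k (fun i => (ℓ i : ℝ)) ν →
        (∀ ν' ∈ HahnRec.nbr j ν, HahnRec.Regular k (fun i => (ℓ i : ℝ)) ν') →
        (∀ ν' ∈ HahnRec.nbr k ν, HahnRec.Regular j (fun i => (ℓ i : ℝ)) ν') →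
        HahnRec.recOp j hj (fun i => (ℓ i : ℝ)) N
            (HahnRec.recOp k hk (fun i => (ℓ i : ℝ)) N f) ν =
          HahnRec.recOp k hk (fun i => (ℓ i : ℝ)) N
            (HahnRec.recOp j hj (fun i => (ℓ i : ℝ)) N f) ν)) := by
  refine ⟨fun ℓ N h => ?_, fun ℓ N _ => ?_⟩
  · obtain ⟨equation, _, comm⟩ := theorem6p2_general ℓ N
    exact ⟨fun k hk _ ν x => equation k hk ν x (h.regular k ν) fun ν' _ => h.inRange ν',
      fun j k hj hk f => funext fun ν => comm j k hj hk f ν (h.regular j ν) (h.regular k ν)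
        (fun ν' _ => h.regular k ν') fun ν' _ => h.regular j ν'⟩
  · obtain ⟨equation, equation_natCast, comm⟩ := theorem6p2_general (fun i => (ℓ i : ℝ)) N
    exact ⟨fun k hk _ ν x hH => equation k hk ν x (HahnRec.regular_of_nbr_subset hH)
        fun ν' hν' => HahnRec.inRange_of_mem_H (hH hν'),
      fun k hk _ ν hν x hx hreg => equation_natCast k hk ν x hreg
        (HahnRec.inRange_of_mem_H hν) (HahnRec.inRange_of_mem_V hx),
      comm⟩
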